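/- **Setting and notation.** Let $d\ge 1$, let $(\Omega,\mathcal F,\mathbb P)$ be a probability space with a filtration $(\mathcal F_t)_{t\ge 0}$, write $\mathbb E_t[\cdot]=\mathbb E[\cdot\mid\mathcal F_t]$, and let $(X_t)_{t\ge 1}$ be random vectors in $\mathbb R^d$ adapted to $(\mathcal F_t)$ with $\|X_t\|\le 1/2$ almost surely for all $t\ge1$. For $t\ge 0$ put $$S_t:=\sum_{s=1}^t (X_s-\mathbb E_{s-1}X_s),\qquad V_t:=\sum_{s=1}^t (X_s-\hat\mu_{s-1})(X_s-\hat\mu_{s-1})^\top,\qquad \hat\mu_t:=\frac1t\sum_{s=1}^tX_s,\quad \hat\mu_0:=0.$$ A function $\psi:[0,\lambda_{\max})\to[0,\infty)$ is *CGF-like* if it is $C^2$, strictly convex, $\psi(0)=\psi'(0)=0$ and $\psi''(0)>0$. For such $\psi$, an adapted pair $(S_t,V_t)_{t\ge0}$ with values in $\mathbb R^d$ and in the positive semidefinite $d\times d$ matrices is *sub-$\psi$* ($S_t$ is sub-$\psi$ with variance proxy $V_t$) if for each unit vector $\nu$ and each $\lambda\in[0,\lambda_{\max})$ there is a nonnegative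 $(\mathcal F_t)$-supermartingale $(L_t)_{t\ge0}$ with $\mathbb E L_0\le 1$ and $\exp\{\lambda\langle\nu,S_t\rangle-\psi(\lambda)\langle\nu,V_t\nu\rangle\}\le L_t$ almost surely for all $t\ge0$. Let $$\psi_{E,1}(\lambda)=-\log(1-\lambda)-\lambda,\qquad \psi_{G,1}(\lambda)=\frac{\lambda^2}{2(1-\lambda)}\qquad(\lambda\in[0,1)),$$ let $\psi_{E,1}^*(u)=\sup_{\lambda\in[0,1)}(u\lambda-\psi_{E,1}(\lambda))$ for $u\ge 0$, and let $(\psi_{E,1}^*)^{-1}:[0,\infty)\to[0,\infty)$ be its inverse function. For a positive semidefinite matrix $V=\sum_n\gamma_nv_nv_n^\top$ (spectral decomposition) and $\rho>0$ let $V\vee\rho:=\sum_n\max(\gamma_n,\rho)v_nv_n^\top$. Let $\gamma_{\min},\gamma_{\max}$ denote smallest and largest eigenvalue, and $\kappa=\gamma_{\max}/\gamma_{\min}$. For $r>0$ let $N_{d-1}(r)$ be the smallest cardinality of a subset $K$ of the unit sphere of $\mathbb R^d$ such that every point of the sphere is within Euclidean distance $r$ of $K$. Given $\rho>0$, $\alpha>1$,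 $\beta>1$, $\epsilon\in(0,1)$, $\delta\in(0,1)$ and a nondecreasing $h:[0,\infty)\to(0,\infty)$ with $\sum_{k=0}^\infty h(k)^{-1}\le1$, put $$L^\delta_\rho(V):=\log h\!\left(\log_\alpha\frac{\gamma_{\max}(V\vee\rho)}{\rho}\right)+\log\!\left(\frac1\delta\cdot\frac1{1-\beta^{-1}}\right)+\log\!\left(\beta\sqrt{\kappa(V\vee\rho)}\;N_{d-1}\!\left(\frac{\epsilon}{\beta\sqrt{\kappa(V\vee\rho)}}\right)\right).$$ **Theorem 6.1.** The process $(S_t)_{t\ge0}$ is sub-$\psi_{E,1}$ with variance proxy $(V_t)_{t\ge0}$, and also sub-$\psi_{G,1}$ with the same variance proxy. For every choice of $\rho,\alpha,\beta,\epsilon,\delta,h$ as above, $$\mathbb P\left(\exists t\ge0:\ \big\|(V_t\vee\rho)^{-1/2}S_t\big\|\ \ge\ \frac{\sqrt{\gamma_{\min}(V_t\vee\rho)}}{1-\epsilon}\,(\psi_{E,1}^*)^{-1}\!\left(\frac{\alpha L^\delta_\rho(V_t)}{\gamma_{\min}(V_t\vee\rho)}\right)\right)\le\delta,$$ and, with probability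 at least $1-\delta$, simultaneously for all $t\ge0$, $$\big\|(V_t\vee\rho)^{-1/2}S_t\big\|\ \le\ \frac1{1-\epsilon}\left[\sqrt{2\alpha L^\delta_\rho(V_t)}+\frac{\alpha L^\delta_\rho(V_t)}{\sqrt{\gamma_{\min}(V_t\vee\rho)}}\right].$$ -/

import Mathlib

open MeasureTheory ProbabilityTheory
open scoped Matrix

noncomputable section

namespace EmpBern

/-- The interval `[0, lmax)`, where `lmax` may be infinite. -/
def cgfDomain (lmax : EReal) : Set ℝ := {l : ℝ | 0 ≤ l ∧ (l : EReal) < lmax}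

/-- CGF-like functions `ψ : [0, lmax) → [0, ∞)`: twice continuously differentiable, strictly
convex, `ψ(0) = ψ'(0) = 0` and `ψ''(0) > 0` (one-sided derivatives at `0`). Only the values of `ψ`
on `[0, lmax)` matter. -/
structure IsCGFLike (ψ : ℝ → ℝ) (lmax : EReal) : Prop where
  lmax_pos : 0 < lmax
  nonneg : ∀ l ∈ cgfDomain lmax, 0 ≤ ψ l
  contDiffOn : ContDiffOn ℝ 2 ψ (cgfDomain lmax)
  strictConvexOn : StrictConvexOn ℝ (cgfDomain lmax) ψ
  map_zero : ψ 0 = 0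
  deriv_zero : derivWithin ψ (cgfDomain lmax) 0 = 0
  deriv_two_pos : 0 < iteratedDerivWithin 2 ψ (cgfDomain lmax) 0

/-- `ψ_{E,c}(l) = (-log(1 - c l) - c l) / c²`, considered on `[0, 1/c)`. -/
def psiE (c l : ℝ) : ℝ := (-Real.log (1 - c * l) - c * l) / c ^ 2

/-- `ψ_{G,c}(l) = l² / (2 (1 - c l))`, considered on `[0, 1/c)`. -/
def psiG (c l : ℝ) : ℝ := l ^ 2 / (2 * (1 - c * l))

/-- The convex conjugate `ψ^*(u) = sup_{l ∈ [0, lmax)} (u l - ψ(l))`. -/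
def convexConj (ψ : ℝ → ℝ) (lmax : EReal) (u : ℝ) : ℝ :=
  sSup ((fun l : ℝ => u * l - ψ l) '' cgfDomain lmax)

/-- The inverse `(ψ^*)⁻¹` of the convex conjugate as a function on `[0, ∞)`. -/
def convexConjInv (ψ : ℝ → ℝ) (lmax : EReal) : ℝ → ℝ :=
  Function.invFunOn (convexConj ψ lmax) (Set.Ici 0)

variable {Ω : Type*} {mΩ : MeasurableSpace Ω} {d : ℕ}

/-- The real process `S` is sub-`ψ` with variance proxy `V`: for each `l ∈ [0, lmax)` the process
`exp (l S_t - ψ(l) V_t)` is almost surely dominated by a nonnegative supermartingale of initial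
expectation at most one. -/
structure IsSubPsiScalar (μ : Measure Ω) (ℱ : Filtration ℕ mΩ) (ψ : ℝ → ℝ) (lmax : EReal)
    (S V : ℕ → Ω → ℝ) : Prop where
  cgfLike : IsCGFLike ψ lmax
  adapted_S : StronglyAdapted ℱ S
  adapted_V : StronglyAdapted ℱ V
  V_nonneg : ∀ t ω, 0 ≤ V t ω
  exists_supermartingale : ∀ l ∈ cgfDomain lmax, ∃ L : ℕ → Ω → ℝ,
    Supermartingale L ℱ μ ∧ (∀ t ω, 0 ≤ L t ω) ∧ (∫ ω, L 0 ω ∂μ) ≤ 1 ∧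
      ∀ t, ∀ᵐ ω ∂μ, Real.exp (l * S t ω - ψ l * V t ω) ≤ L t ω

/-- The `ℝ^d`-valued process `S` is sub-`ψ` with positive semidefinite variance proxy `V`: in each
direction `ν` of the unit sphere, `⟨ν, S_t⟩` is sub-`ψ` with variance proxy `⟨ν, V_t ν⟩`. -/
structure IsSubPsi (μ : Measure Ω) (ℱ : Filtration ℕ mΩ) (ψ : ℝ → ℝ) (lmax : EReal)
    (S : ℕ → Ω → EuclideanSpace ℝ (Fin d)) (V : ℕ → Ω → Matrix (Fin d) (Fin d) ℝ) : Prop where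
  cgfLike : IsCGFLike ψ lmax
  adapted_S : StronglyAdapted ℱ S
  adapted_V : StronglyAdapted ℱ V
  V_posSemidef : ∀ t ω, (V t ω).PosSemidef
  projection : ∀ ν : EuclideanSpace ℝ (Fin d), ‖ν‖ = 1 →
    IsSubPsiScalar μ ℱ ψ lmax (fun t ω => inner ℝ ν (S t ω))
      (fun t ω => inner ℝ ν (WithLp.toLp 2 (V t ω *ᵥ ν.ofLp)))

/-- `S_t = ∑_{s=1}^t (X_s - E[X_s | ℱ_{s-1}])`. -/
def centeredSum (μ : Measure Ω) (ℱ : Filtration ℕ mΩ) (X : ℕ → Ω → EuclideanSpace ℝ (Fin d))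
    (t : ℕ) (ω : Ω) : EuclideanSpace ℝ (Fin d) :=
  ∑ s ∈ Finset.Icc 1 t, (X s ω - (μ[X s | ℱ (s - 1)]) ω)

/-- The empirical mean `t⁻¹ ∑_{s=1}^t X_s` (equal to `0` at `t = 0`). -/
def empMean (X : ℕ → Ω → EuclideanSpace ℝ (Fin d)) (t : ℕ) (ω : Ω) : EuclideanSpace ℝ (Fin d) :=
  (t : ℝ)⁻¹ • ∑ s ∈ Finset.Icc 1 t, X s ω

/-- `V_t = ∑_{s=1}^t (X_s - μ̂_{s-1}) (X_s - μ̂_{s-1})ᵀ`. -/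
def empVar (X : ℕ → Ω → EuclideanSpace ℝ (Fin d)) (t : ℕ) (ω : Ω) : Matrix (Fin d) (Fin d) ℝ :=
  ∑ s ∈ Finset.Icc 1 t,
    Matrix.vecMulVec (X s ω - empMean X (s - 1) ω).ofLp (X s ω - empMean X (s - 1) ω).ofLp

/-- Smallest eigenvalue (of a symmetric matrix, `d ≥ 1`). -/
def gammaMin (A : Matrix (Fin d) (Fin d) ℝ) : ℝ := sInf (spectrum ℝ A)

/-- Largest eigenvalue (of a symmetric matrix, `d ≥ 1`). -/
def gammaMax (A : Matrix (Fin d) (Fin d) ℝ) : ℝ := sSup (spectrum ℝ A)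

/-- Condition number of a positive definite matrix. -/
def kappa (A : Matrix (Fin d) (Fin d) ℝ) : ℝ := gammaMax A / gammaMin A

/-- `V ∨ ρ I_d`: each eigenvalue `γ` in the spectral decomposition of the symmetric matrix `V` is
replaced by `max γ ρ`. -/
def specMax (V : Matrix (Fin d) (Fin d) ℝ) (ρ : ℝ) : Matrix (Fin d) (Fin d) ℝ :=
  cfc (fun x : ℝ => max x ρ) V

/-- `A^{-1/2}` for a positive definite matrix `A`, through its spectral decomposition. -/
def invSqrt (A : Matrix (Fin d) (Fin d) ℝ) : Matrix (Fin d) (Fin d) ℝ :=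
  cfc (fun x : ℝ => (Real.sqrt x)⁻¹) A

/-- The Euclidean norm `‖(V ∨ ρ I_d)^{-1/2} S‖`. -/
def selfNorm (V : Matrix (Fin d) (Fin d) ℝ) (ρ : ℝ) (S : EuclideanSpace ℝ (Fin d)) : ℝ :=
  ‖(WithLp.toLp 2 (invSqrt (specMax V ρ) *ᵥ S.ofLp) : EuclideanSpace ℝ (Fin d))‖

/-- `N_{d-1}(r)`: the smallest cardinality of a subset `K` of the unit sphere of `ℝ^d` such that
each point of the sphere is at Euclidean distance at most `r` from `K` (finite for `r > 0`). -/
def sphereCovering (d : ℕ) (r : ℝ) : ℕ :=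
  (Metric.coveringNumber r.toNNReal (Metric.sphere (0 : EuclideanSpace ℝ (Fin d)) 1)).toNat

/-- `L_ρ^δ(V)`, with parameters `α, β, ε, h`. -/
def Lfun (α β ρ ε δ : ℝ) (h : ℝ → ℝ) (V : Matrix (Fin d) (Fin d) ℝ) : ℝ :=
  Real.log (h (Real.logb α (gammaMax (specMax V ρ) / ρ)))
    + Real.log (1 / δ * (1 / (1 - β⁻¹)))
    + Real.log (β * Real.sqrt (kappa (specMax V ρ))
        * (sphereCovering d (ε / (β * Real.sqrt (kappa (specMax V ρ)))) : ℝ))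

end EmpBern

end

/-! ### The CGF-like functions `ψ_E` and `ψ_G`. -/

namespace EmpBern

/-! Fix a unit vector `ν` and `λ ∈ [0, 1)`. Let `Y = ⟨ν, X_t⟩` have conditional mean `m`, and let `a
= ⟨ν, μ̂_{t-1}⟩`, which is predictable. Fan's inequality (`exp_sub_psiE_le`) at `x = Y - a ≥ -1`
bounds the conditional exponential moment by `1 + λ(m - a) ≤ exp(λ(m - a))`, exactly the factor that
replaces the centring `a` by `m`. Hence the exponential process is a supermartingale, and `ψ_E ≤
ψ_G` transfers this to `ψ_G`.

For the norm bound, Ville's inequality controls one line for each pair `(ν, λ)`, and countably many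
pairs suffice. With `T = (V ∨ ρ)^{1/2}`, the self-normalized norm is the supremum of `⟨ν, S⟩ /
‖Tν‖`; since `T` has condition number `√κ`, a sphere net of radius `ε/√κ` loses only a factor `1 -
ε` (`exists_direction_of_symmetric`). Both `κ` and `v = ‖Tν‖²` are random, so they are stratified
geometrically: `β^j ≤ √κ < β^(j+1)` selects a net and `ρα^k ≤ v < ρα^(k+1)` a slope
(`exists_crossing`). The budgets `stitchProb`, summed over all nets, stay below `δ`, while their
log-inverses stay below `L`. Monotonicity of `√x (ψ_E^*)⁻¹(c/x)` replaces `v` by `γ_min`, and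
`(ψ_E^*)⁻¹(y) ≤ √(2y) + y` makes the boundary explicit. -/

lemma cgfDomain_one : cgfDomain 1 = Set.Ico (0 : ℝ) 1 := by
  ext l
  simp only [cgfDomain, Set.mem_ofPred_eq, Set.mem_Ico]
  norm_cast

/-- Smoothness is asked on all of `(-∞, 1)`, so `0` is an interior point and the one-sided
derivatives there are ordinary ones. -/
lemma isCGFLike_of_hasDerivAt {f f' f'' : ℝ → ℝ} (h1 : ∀ x < 1, HasDerivAt f (f' x) x)
    (h2 : ∀ x < 1, HasDerivAt f' (f'' x) x) (hc : ContDiffOn ℝ 2 f (Set.Iio 1))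
    (hpos : ∀ x, 0 ≤ x → x < 1 → 0 < f'' x) (h0 : f 0 = 0) (h0' : f' 0 = 0)
    (hnn : ∀ x, 0 ≤ x → x < 1 → 0 ≤ f x) : IsCGFLike f 1 := by
  have hd2 : ∀ x < 1, deriv^[2] f x = f'' x := by
    intro x hx
    have : deriv f =ᶠ[nhds x] f' := by
      filter_upwards [Iio_mem_nhds hx] with y hy using (h1 y hy).deriv
    simp only [Function.iterate_succ, Function.iterate_zero, Function.comp, id]
    rw [this.deriv_eq, (h2 x hx).deriv]
  have hu : UniqueDiffOn ℝ (Set.Ico (0 : ℝ) 1) := uniqueDiffOn_Ico 0 1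
  have h00 : (0 : ℝ) ∈ Set.Ico (0 : ℝ) 1 := by simp
  refine ⟨by norm_num, ?_, ?_, ?_, h0, ?_, ?_⟩ <;> rw [cgfDomain_one]
  · exact fun l hl => hnn l hl.1 hl.2
  · exact hc.mono fun x hx => hx.2
  · refine strictConvexOn_of_deriv2_pos (convex_Ico 0 1)
      (hc.continuousOn.mono fun x hx => hx.2) fun x hx => ?_
    rw [interior_Ico] at hx
    rw [hd2 x hx.2]
    exact hpos x hx.1.le hx.2
  · rw [(h1 0 one_pos).hasDerivWithinAt.derivWithin (hu 0 h00), h0']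
  · rw [iteratedDerivWithin_eq_iteratedDeriv hu
      (hc.contDiffAt (Iio_mem_nhds one_pos)) h00, iteratedDeriv_eq_iterate, hd2 0 one_pos]
    exact hpos 0 le_rfl one_pos

lemma psiE_one (l : ℝ) : psiE 1 l = -Real.log (1 - l) - l := by simp [psiE]

lemma psiG_one (l : ℝ) : psiG 1 l = l ^ 2 / (2 * (1 - l)) := by simp [psiG]

lemma psiE_one_nonneg {l : ℝ} (hl : l < 1) : 0 ≤ psiE 1 l := by
  rw [psiE_one]
  have := Real.log_le_sub_one_of_pos (sub_pos.2 hl)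
  linarith

lemma isCGFLike_psiE : IsCGFLike (psiE 1) 1 := by
  have e : psiE 1 = fun l => -Real.log (1 - l) - l := funext psiE_one
  refine isCGFLike_of_hasDerivAt (f' := fun x => (1 - x)⁻¹ - 1) (f'' := fun x => ((1 - x) ^ 2)⁻¹)
    ?_ ?_ ?_ ?_ (by simp [e]) (by simp) fun x _ => psiE_one_nonneg
  · intro x hx
    have hx' : (1 : ℝ) - x ≠ 0 := by linarith
    rw [e]
    refine (((((hasDerivAt_id x).const_sub 1).log hx').neg).sub (hasDerivAt_id x)).congr_deriv ?_
    simp only [id]; ring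
  · intro x hx
    have hx' : (1 : ℝ) - x ≠ 0 := by linarith
    refine ((((hasDerivAt_id x).const_sub 1).inv hx').sub_const 1).congr_deriv ?_
    simp
  · rw [e]
    refine ((ContDiffOn.log (by fun_prop) ?_).neg).sub contDiffOn_id
    intro x hx
    exact (sub_pos.2 hx).ne'
  · intro x _ hx
    have : 0 < 1 - x := by linarith
    positivity

lemma isCGFLike_psiG : IsCGFLike (psiG 1) 1 := by
  have e : psiG 1 = fun l => l ^ 2 / (2 * (1 - l)) := funext psiG_one
  refine isCGFLike_of_hasDerivAt (f' := fun x => (((1 - x) ^ 2)⁻¹ - 1) / 2)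
    (f'' := fun x => ((1 - x) ^ 3)⁻¹) ?_ ?_ ?_ ?_ (by simp [e]) (by simp) ?_
  · intro x hx
    have hx' : (1 : ℝ) - x ≠ 0 := by linarith
    rw [e]
    refine (((hasDerivAt_id x).pow 2).div (((hasDerivAt_id x).const_sub 1).const_mul 2)
      (mul_ne_zero two_ne_zero hx')).congr_deriv ?_
    simp; field_simp; ring
  · intro x hx
    have hx' : (1 : ℝ) - x ≠ 0 := by linarith
    refine (((((((hasDerivAt_id x).const_sub 1).pow 2).inv (pow_ne_zero 2 hx')).sub_const
      1).div_const 2)).congr_deriv ?_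
    simp; field_simp
  · rw [e]
    refine ContDiffOn.div (by fun_prop) (by fun_prop) ?_
    intro x hx
    exact (mul_pos two_pos (sub_pos.2 hx)).ne'
  · intro x _ hx
    have : 0 < 1 - x := by linarith
    positivity
  · intro x _ hx
    have : 0 < 1 - x := by linarith
    rw [e]
    positivity

/-- A differentiable function vanishing at `0` with nonnegative derivative on `[0, b)` is
nonnegative there. -/
lemma nonneg_of_hasDerivAt_Ico {f f' : ℝ → ℝ} {b : ℝ} (h1 : ∀ x, 0 ≤ x → x < b →
    HasDerivAt f (f' x) x) (h' : ∀ x, 0 ≤ x → x < b → 0 ≤ f' x) (h0 : f 0 = 0) {x : ℝ}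
    (hx : 0 ≤ x) (hb : x < b) : 0 ≤ f x := by
  have hm : MonotoneOn f (Set.Icc 0 x) := by
    refine monotoneOn_of_hasDerivWithinAt_nonneg (f' := f') (convex_Icc 0 x) ?_ ?_ ?_
    · exact fun y hy => (h1 y hy.1 (hy.2.trans_lt hb)).continuousAt.continuousWithinAt
    · intro y hy
      rw [interior_Icc] at hy
      exact (h1 y hy.1.le (hy.2.trans hb)).hasDerivWithinAt
    · intro y hy
      rw [interior_Icc] at hy
      exact h' y hy.1.le (hy.2.trans hb)
  simpa [h0] using hm (Set.left_mem_Icc.2 hx) (Set.right_mem_Icc.2 hx) hx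

/-- The difference vanishes at `0` and has derivative `((1 - x)⁻¹ - 1)² / 2`. -/
lemma psiE_le_psiG {l : ℝ} (h0 : 0 ≤ l) (h1 : l < 1) : psiE 1 l ≤ psiG 1 l := by
  have key := nonneg_of_hasDerivAt_Ico (b := 1)
    (f := fun x => x ^ 2 / (2 * (1 - x)) + Real.log (1 - x) + x)
    (f' := fun x => (((1 - x) ^ 2)⁻¹ - 1) / 2 - (1 - x)⁻¹ + 1) ?_ ?_ (by simp) h0 h1
  · rw [psiE_one, psiG_one]; linarith
  · intro x _ hx
    have hx' : (1 : ℝ) - x ≠ 0 := by linarith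
    refine (((((hasDerivAt_id x).pow 2).div (((hasDerivAt_id x).const_sub 1).const_mul 2)
      (mul_ne_zero two_ne_zero hx')).add (((hasDerivAt_id x).const_sub 1).log hx')).add
      (hasDerivAt_id x)).congr_deriv ?_
    simp; field_simp; ring
  · intro x _ hx
    have := sq_nonneg ((1 - x)⁻¹ - 1)
    rw [← inv_pow]
    nlinarith

/-! ### Logarithmic inequalities and Fan's inequality. -/

lemma one_add_mul_pos {y s : ℝ} (hy : -1 < y) (h0 : 0 ≤ s) (h1 : s ≤ 1) : 0 < 1 + s * y := by
  rcases le_or_gt 0 y with h | h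
  · positivity
  · nlinarith

/-- `y - log (1 + y) = y² ∫₀¹ s / (1 + s y) ds`. -/
lemma sub_log_eq_integral {y : ℝ} (hy : -1 < y) :
    y - Real.log (1 + y) = y ^ 2 * ∫ s in (0 : ℝ)..1, s / (1 + s * y) := by
  have hpos : ∀ s ∈ Set.uIcc (0 : ℝ) 1, 0 < 1 + s * y := by
    intro s hs
    rw [Set.uIcc_of_le zero_le_one] at hs
    exact one_add_mul_pos hy hs.1 hs.2
  have hc : ContinuousOn (fun s : ℝ => y ^ 2 * (s / (1 + s * y))) (Set.uIcc 0 1) :=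
    continuousOn_const.mul (ContinuousOn.div (by fun_prop) (by fun_prop)
      fun s hs => (hpos s hs).ne')
  rw [← intervalIntegral.integral_const_mul, intervalIntegral.integral_eq_sub_of_hasDerivAt
    (f := fun s => s * y - Real.log (1 + s * y)) ?_ hc.intervalIntegrable]
  · simp
  · intro s hs
    have h1 : HasDerivAt (fun s : ℝ => s * y) y s := hasDerivAt_mul_const y
    have h0 := (hpos s hs).ne'
    refine (h1.sub ((h1.const_add 1).log h0)).congr_deriv ?_
    rw [mul_comm s y] at h0 ⊢
    field_simp
    ring

/-- The function `(y - log (1 + y)) / y²` is nonincreasing on `(-1, ∞)`. -/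
lemma sub_log_mul_sq_le {a b : ℝ} (ha : -1 < a) (hab : a ≤ b) :
    (b - Real.log (1 + b)) * a ^ 2 ≤ (a - Real.log (1 + a)) * b ^ 2 := by
  have hpos : ∀ y, -1 < y → ∀ s ∈ Set.Icc (0 : ℝ) 1, 0 < 1 + s * y := by
    exact fun y hy s hs => one_add_mul_pos hy hs.1 hs.2
  have hc : ∀ y, -1 < y → IntervalIntegrable (fun s : ℝ => s / (1 + s * y)) volume 0 1 := by
    intro y hy
    refine ContinuousOn.intervalIntegrable ?_
    rw [Set.uIcc_of_le zero_le_one]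
    exact ContinuousOn.div (by fun_prop) (by fun_prop) fun s hs => (hpos y hy s hs).ne'
  have hb := ha.trans_le hab
  have hI : ∫ s in (0 : ℝ)..1, s / (1 + s * b) ≤ ∫ s in (0 : ℝ)..1, s / (1 + s * a) := by
    refine intervalIntegral.integral_mono_on zero_le_one (hc b hb) (hc a ha) fun s hs => ?_
    exact div_le_div_of_nonneg_left hs.1 (hpos a ha s hs)
      (by nlinarith [hs.1])
  rw [sub_log_eq_integral ha, sub_log_eq_integral hb]
  -- Multiplying by `a² b²` instead of dividing keeps `a = 0` and `b = 0` in scope.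
  have := mul_le_mul_of_nonneg_left hI (mul_nonneg (sq_nonneg a) (sq_nonneg b))
  linarith

/-- Fan's inequality. -/
lemma exp_sub_psiE_le {l x : ℝ} (h0 : 0 ≤ l) (h1 : l < 1) (hx : -1 ≤ x) :
    Real.exp (l * x - psiE 1 l * x ^ 2) ≤ 1 + l * x := by
  rcases h0.eq_or_lt with rfl | h0
  · simp [psiE_one]
  have hpos : 0 < 1 + l * x := by nlinarith
  rw [← Real.le_log_iff_exp_le hpos, psiE_one]
  -- The value at `-l` is `ψ_E(l)`, and `x ≥ -1` says exactly that `-l ≤ l x`.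
  have := sub_log_mul_sq_le (a := -l) (b := l * x) (by linarith) (by nlinarith)
  have h2 : l * x - Real.log (1 + l * x) ≤ (-l - Real.log (1 + -l)) * x ^ 2 := by
    have hl2 : 0 < l ^ 2 := by positivity
    refine le_of_mul_le_mul_right ?_ hl2
    linarith
  rw [← sub_eq_add_neg] at h2
  linarith

/-! ### The conjugate of `ψ_E` and its inverse. -/

/-- The convex conjugate of `psiE 1`, attained at `u / (1 + u)`. -/
lemma mul_div_sub_psiE {u : ℝ} (hu : 0 ≤ u) :
    u * (u / (1 + u)) - psiE 1 (u / (1 + u)) = u - Real.log (1 + u) := by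
  have h : 0 < 1 + u := by linarith
  have e : 1 - u / (1 + u) = (1 + u)⁻¹ := by field_simp; ring
  rw [psiE_one, e, Real.log_inv]
  field_simp; ring

/-- This is `log z ≤ z - 1` at `z = (1 + u)(1 - l)`, with equality at `l = u / (1 + u)`. -/
lemma mul_sub_psiE_le {u l : ℝ} (hu : 0 ≤ u) (hl : l < 1) :
    u * l - psiE 1 l ≤ u - Real.log (1 + u) := by
  have h : 0 < 1 + u := by linarith
  have hl' : 0 < 1 - l := by linarith
  have := Real.log_le_sub_one_of_pos (mul_pos h hl')
  rw [Real.log_mul h.ne' hl'.ne'] at this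
  rw [psiE_one]
  linarith

lemma div_one_add_mem {u : ℝ} (hu : 0 ≤ u) : u / (1 + u) ∈ Set.Ico (0 : ℝ) 1 :=
  ⟨by positivity, (div_lt_one (by linarith)).2 (by linarith)⟩

lemma convexConj_psiE {u : ℝ} (hu : 0 ≤ u) :
    convexConj (psiE 1) 1 u = u - Real.log (1 + u) := by
  rw [convexConj, cgfDomain_one]
  refine IsGreatest.csSup_eq ⟨⟨u / (1 + u), div_one_add_mem hu, mul_div_sub_psiE hu⟩, ?_⟩
  rintro _ ⟨l, hl, rfl⟩
  exact mul_sub_psiE_le hu hl.2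

lemma strictMonoOn_sub_log : StrictMonoOn (fun u : ℝ => u - Real.log (1 + u)) (Set.Ici 0) := by
  intro a ha b hb hab
  have ha' : 0 < 1 + a := by linarith [Set.mem_Ici.1 ha]
  have hb' : 0 < 1 + b := by linarith
  have h : Real.log ((1 + b) / (1 + a)) < (1 + b) / (1 + a) - 1 :=
    Real.log_lt_sub_one_of_pos (by positivity) (by rw [Ne, div_eq_one_iff_eq ha'.ne']; linarith)
  rw [Real.log_div hb'.ne' ha'.ne'] at h
  have h2 : (1 + b) / (1 + a) - 1 ≤ b - a := by
    rw [div_sub_one ha'.ne', div_le_iff₀ ha']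
    nlinarith [Set.mem_Ici.1 ha]
  simp only
  linarith

/-- `ψ_E^*(s + s²/2) ≥ s²/2`. -/
lemma half_sq_le_sub_log {s : ℝ} (hs : 0 ≤ s) :
    s ^ 2 / 2 ≤ (s + s ^ 2 / 2) - Real.log (1 + (s + s ^ 2 / 2)) := by
  have h := Real.quadratic_le_exp_of_nonneg hs
  have := (Real.log_le_iff_le_exp (by positivity)).2 h
  rw [add_assoc] at this
  linarith

/-- `Function.invFunOn` is only meaningful on the range, so a preimage must exist: the intermediate
value theorem on `[0, s + s²/2]` with `s = √(2y)` provides one. -/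
lemma convexConjInv_psiE_spec {y : ℝ} (hy : 0 ≤ y) :
    0 ≤ convexConjInv (psiE 1) 1 y ∧
      convexConjInv (psiE 1) 1 y - Real.log (1 + convexConjInv (psiE 1) 1 y) = y := by
  have hex : ∃ a ∈ Set.Ici (0 : ℝ), convexConj (psiE 1) 1 a = y := by
    set s := Real.sqrt (2 * y) with hs
    have hs0 : 0 ≤ s := Real.sqrt_nonneg _
    have hs2 : s ^ 2 / 2 = y := by rw [hs, Real.sq_sqrt (by positivity)]; ring
    have h1 := half_sq_le_sub_log hs0
    have hc : ContinuousOn (fun u : ℝ => u - Real.log (1 + u)) (Set.Icc 0 (s + s ^ 2 / 2)) := by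
      refine continuousOn_id.sub (ContinuousOn.log (by fun_prop) fun x hx => ?_)
      linarith [hx.1]
    obtain ⟨u, hu, hu'⟩ := intermediate_value_Icc (by positivity) hc
      (show y ∈ Set.Icc _ _ from ⟨by simpa using hy, by rw [← hs2] ; exact h1⟩)
    exact ⟨u, hu.1, by rw [convexConj_psiE hu.1]; exact hu'⟩
  have h1 : 0 ≤ convexConjInv (psiE 1) 1 y := Function.invFunOn_mem hex
  refine ⟨h1, ?_⟩
  rw [← convexConj_psiE h1]
  exact Function.invFunOn_eq hex

lemma convexConjInv_psiE_le {y u : ℝ} (hy : 0 ≤ y) (hu : 0 ≤ u) (h : y ≤ u - Real.log (1 + u)) :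
    convexConjInv (psiE 1) 1 y ≤ u := by
  obtain ⟨h0, h1⟩ := convexConjInv_psiE_spec hy
  rw [← h1] at h
  exact (strictMonoOn_sub_log.le_iff_le h0 hu).1 h

lemma le_convexConjInv_psiE {y u : ℝ} (hy : 0 ≤ y) (hu : 0 ≤ u) (h : u - Real.log (1 + u) ≤ y) :
    u ≤ convexConjInv (psiE 1) 1 y := by
  obtain ⟨h0, h1⟩ := convexConjInv_psiE_spec hy
  rw [← h1] at h
  exact (strictMonoOn_sub_log.le_iff_le hu h0).1 h

lemma convexConjInv_psiE_pos {y : ℝ} (hy : 0 < y) : 0 < convexConjInv (psiE 1) 1 y := by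
  obtain ⟨h0, h1⟩ := convexConjInv_psiE_spec hy.le
  refine h0.lt_of_ne fun h => ?_
  rw [← h] at h1
  simp at h1
  exact hy.ne h1

lemma convexConjInv_psiE_mono {x y : ℝ} (hx : 0 ≤ x) (hxy : x ≤ y) :
    convexConjInv (psiE 1) 1 x ≤ convexConjInv (psiE 1) 1 y := by
  obtain ⟨h0, h1⟩ := convexConjInv_psiE_spec hx
  exact le_convexConjInv_psiE (hx.trans hxy) h0 (h1.le.trans hxy)

/-- `(ψ_E^*)⁻¹(y) ≤ √(2y) + y`. -/
lemma convexConjInv_psiE_le_sqrt {y : ℝ} (hy : 0 ≤ y) :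
    convexConjInv (psiE 1) 1 y ≤ Real.sqrt (2 * y) + y := by
  have h := half_sq_le_sub_log (Real.sqrt_nonneg (2 * y))
  have e : Real.sqrt (2 * y) ^ 2 / 2 = y := by rw [Real.sq_sqrt (by positivity)]; ring
  rw [e] at h
  exact convexConjInv_psiE_le hy (by positivity) h

/-- `√x (ψ_E^*)⁻¹(c/x)` is nonincreasing in `x`. -/
lemma sqrt_mul_convexConjInv_psiE_anti {c x y : ℝ} (hc : 0 < c) (hx : 0 < x) (hxy : x ≤ y) :
    Real.sqrt y * convexConjInv (psiE 1) 1 (c / y) ≤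
      Real.sqrt x * convexConjInv (psiE 1) 1 (c / x) := by
  have hy := hx.trans_le hxy
  obtain ⟨-, hv⟩ := convexConjInv_psiE_spec (div_pos hc hx).le
  obtain ⟨-, hu⟩ := convexConjInv_psiE_spec (div_pos hc hy).le
  have hupos := convexConjInv_psiE_pos (div_pos hc hy)
  have hvpos := convexConjInv_psiE_pos (div_pos hc hx)
  have huv : convexConjInv (psiE 1) 1 (c / y) ≤ convexConjInv (psiE 1) 1 (c / x) :=
    convexConjInv_psiE_mono (div_pos hc hy).le (div_le_div_of_nonneg_left hc.le hx hxy)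
  set u := convexConjInv (psiE 1) 1 (c / y)
  set v := convexConjInv (psiE 1) 1 (c / x)
  -- Since `u - log(1+u) = c/y` and `v - log(1+v) = c/x`, this reads `(c/x) u² ≤ (c/y) v²`, the
  -- squared claim up to a factor.
  have h := sub_log_mul_sq_le (by linarith) huv
  rw [hv, hu] at h
  have h2 : y * u ^ 2 ≤ x * v ^ 2 := by
    have e1 : c / x * u ^ 2 = (c / (x * y)) * (y * u ^ 2) := by field_simp
    have e2 : c / y * v ^ 2 = (c / (x * y)) * (x * v ^ 2) := by field_simp
    rw [e1, e2] at h
    exact le_of_mul_le_mul_left h (by positivity)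
  refine le_of_sq_le_sq ?_ (by positivity)
  rw [mul_pow, mul_pow, Real.sq_sqrt hx.le, Real.sq_sqrt hy.le]
  exact h2

end EmpBern

/-! ### Ville's inequality and line crossing. -/

namespace EmpBern

variable {Ω : Type*} {mΩ : MeasurableSpace Ω} {d : ℕ}

/-- **Ville's inequality** over a finite horizon. -/
lemma ville_finite {μ : Measure Ω} [IsFiniteMeasure μ] {ℱ : Filtration ℕ mΩ} {L : ℕ → Ω → ℝ}
    (hL : Supermartingale L ℱ μ) (hnn : ∀ t ω, 0 ≤ L t ω) {c : ℝ} (hc : 0 < c) (n : ℕ) :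
    μ {ω | ∃ t ≤ n, c ≤ L t ω} ≤ ENNReal.ofReal ((∫ ω, L 0 ω ∂μ) / c) := by
  -- First entrance into `[c, ∞)`, or `n` if there is none by then; being bounded, it permits
  -- optional stopping.
  set τ : Ω → ℕ∞ := fun ω => (hittingBtwn L (Set.Ici c) 0 n ω : ℕ) with hτdef
  have hτ : IsStoppingTime ℱ τ :=
    hL.stronglyAdapted.adapted.isStoppingTime_hittingBtwn measurableSet_Ici
  have hτn : ∀ ω, τ ω ≤ n := fun ω => by
    simpa [hτdef] using hittingBtwn_le (u := L) (s := Set.Ici c) (n := 0) (m := n) ω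
  have hint : Integrable (stoppedValue L τ) μ := integrable_stoppedValue ℕ hτ hL.integrable hτn
  have h0 : ∀ ω, 0 ≤ stoppedValue L τ ω := fun ω => hnn _ _
  -- Optional stopping is applied to the submartingale `-L`.
  have hmono := hL.neg.expected_stoppedValue_mono (isStoppingTime_const ℱ 0) hτ
    (fun ω => zero_le) hτn
  have hle : ∫ ω, stoppedValue L τ ω ∂μ ≤ ∫ ω, L 0 ω ∂μ := by
    have e : stoppedValue (-L) τ = fun ω => -stoppedValue L τ ω := rfl
    have e0 : stoppedValue (-L) (fun _ => ((0 : ℕ) : ℕ∞)) = fun ω => -L 0 ω := rfl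
    erw [e, e0, integral_neg, integral_neg] at hmono
    linarith
  have hsub : {ω | ∃ t ≤ n, c ≤ L t ω} ⊆ {ω | c ≤ stoppedValue L τ ω} := by
    rintro ω ⟨t, ht, hct⟩
    exact stoppedValue_hittingBtwn_mem (s := Set.Ici c) ⟨t, ⟨zero_le, ht⟩, hct⟩
  refine (measure_mono hsub).trans ?_
  have hm := mul_meas_ge_le_integral_of_nonneg (Filter.Eventually.of_forall h0) hint c
  rw [← ENNReal.ofReal_toReal (measure_ne_top μ {ω | c ≤ stoppedValue L τ ω})]
  refine ENNReal.ofReal_le_ofReal ?_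
  rw [le_div_iff₀ hc, mul_comm]
  exact hm.trans hle

/-- **Ville's inequality** for nonnegative supermartingales. -/
lemma ville {μ : Measure Ω} [IsFiniteMeasure μ] {ℱ : Filtration ℕ mΩ} {L : ℕ → Ω → ℝ}
    (hL : Supermartingale L ℱ μ) (hnn : ∀ t ω, 0 ≤ L t ω) {c : ℝ} (hc : 0 < c) :
    μ {ω | ∃ t, c ≤ L t ω} ≤ ENNReal.ofReal ((∫ ω, L 0 ω ∂μ) / c) := by
  have e : {ω | ∃ t, c ≤ L t ω} = ⋃ n, {ω | ∃ t ≤ n, c ≤ L t ω} := by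
    ext ω
    simp only [Set.mem_ofPred_eq, Set.mem_iUnion]
    exact ⟨fun ⟨t, ht⟩ => ⟨t, t, le_rfl, ht⟩, fun ⟨_, t, _, ht⟩ => ⟨t, ht⟩⟩
  have hmon : Monotone fun n => {ω | ∃ t ≤ n, c ≤ L t ω} :=
    fun m n hmn ω ⟨t, ht, h⟩ => ⟨t, ht.trans hmn, h⟩
  rw [e, hmon.measure_iUnion]
  exact iSup_le fun n => ville_finite hL hnn hc n

/-- Line-crossing inequality for sub-`ψ` processes. -/
lemma IsSubPsiScalar.measure_crossing_le {μ : Measure Ω} [IsFiniteMeasure μ] {ℱ : Filtration ℕ mΩ}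
    {ψ : ℝ → ℝ} {lmax : EReal} {S V : ℕ → Ω → ℝ} (hs : IsSubPsiScalar μ ℱ ψ lmax S V)
    {l : ℝ} (hl : l ∈ cgfDomain lmax) {p : ℝ} (hp : 0 < p) :
    μ {ω | ∃ t, Real.log (1 / p) ≤ l * S t ω - ψ l * V t ω} ≤ ENNReal.ofReal p := by
  obtain ⟨L, hL, hnn, h1, hdom⟩ := hs.exists_supermartingale l hl
  have hp' : 0 < 1 / p := by positivity
  calc _ ≤ μ {ω | ∃ t, 1 / p ≤ L t ω} := by
        refine measure_mono_ae ?_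
        filter_upwards [ae_all_iff.2 hdom] with ω hω ⟨t, ht⟩
        exact ⟨t, ((Real.log_le_iff_le_exp hp').1 ht).trans (hω t)⟩
    _ ≤ ENNReal.ofReal ((∫ ω, L 0 ω ∂μ) / (1 / p)) := ville hL hnn hp'
    _ ≤ ENNReal.ofReal p := by
        refine ENNReal.ofReal_le_ofReal ?_
        rw [div_div_eq_mul_div, div_one]
        exact mul_le_of_le_one_left hp.le h1

/-! ### The empirical Bernstein supermartingale. -/

section EmpiricalBernstein

variable {μ : Measure Ω} {ℱ : Filtration ℕ mΩ} {X : ℕ → Ω → EuclideanSpace ℝ (Fin d)}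

lemma stronglyMeasurable_empMean
    (hX : ∀ t, 1 ≤ t → StronglyMeasurable[ℱ t] (X t)) (t : ℕ) :
    StronglyMeasurable[ℱ t] (empMean X t) := by
  have e : empMean X t = (t : ℝ)⁻¹ • ∑ s ∈ Finset.Icc 1 t, X s := by
    ext1 ω
    simp [empMean, Finset.sum_apply]
  rw [e]
  refine StronglyMeasurable.const_smul (Finset.stronglyMeasurable_sum _ fun s hs => ?_) _
  rw [Finset.mem_Icc] at hs
  exact (hX s hs.1).mono (ℱ.mono hs.2)

lemma stronglyAdapted_centeredSum
    (hX : ∀ t, 1 ≤ t → StronglyMeasurable[ℱ t] (X t)) :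
    StronglyAdapted ℱ (centeredSum μ ℱ X) := by
  intro t
  have e : centeredSum μ ℱ X t = ∑ s ∈ Finset.Icc 1 t, (X s - μ[X s | ℱ (s - 1)]) := by
    ext1 ω
    simp [centeredSum, Finset.sum_apply]
  rw [e]
  refine Finset.stronglyMeasurable_sum _ fun s hs => ?_
  rw [Finset.mem_Icc] at hs
  exact ((hX s hs.1).mono (ℱ.mono hs.2)).sub
    (stronglyMeasurable_condExp.mono (ℱ.mono (by omega)))

lemma stronglyAdapted_empVar
    (hX : ∀ t, 1 ≤ t → StronglyMeasurable[ℱ t] (X t)) :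
    StronglyAdapted ℱ (empVar X) := by
  intro t
  have e : empVar X t = ∑ s ∈ Finset.Icc 1 t, fun ω =>
      Matrix.vecMulVec (X s ω - empMean X (s - 1) ω).ofLp (X s ω - empMean X (s - 1) ω).ofLp := by
    ext1 ω
    simp [empVar, Finset.sum_apply]
  rw [e]
  refine Finset.stronglyMeasurable_sum _ fun s hs => ?_
  rw [Finset.mem_Icc] at hs
  have hc : Continuous fun v : EuclideanSpace ℝ (Fin d) => Matrix.vecMulVec v.ofLp v.ofLp := by
    fun_prop
  exact hc.comp_stronglyMeasurable (((hX s hs.1).mono (ℱ.mono hs.2)).sub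
    ((stronglyMeasurable_empMean hX (s - 1)).mono (ℱ.mono (by omega))))

lemma posSemidef_empVar (t : ℕ) (ω : Ω) : (empVar X t ω).PosSemidef := by
  refine Matrix.posSemidef_sum _ fun s _ => ?_
  simpa using Matrix.posSemidef_vecMulVec_self_star (X s ω - empMean X (s - 1) ω).ofLp

lemma inner_empVar (ν : EuclideanSpace ℝ (Fin d)) (t : ℕ) (ω : Ω) :
    inner ℝ ν (WithLp.toLp 2 (empVar X t ω *ᵥ ν.ofLp)) =
      ∑ s ∈ Finset.Icc 1 t, (inner ℝ ν (X s ω - empMean X (s - 1) ω)) ^ 2 := by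
  simp only [empVar, Matrix.sum_mulVec, EuclideanSpace.inner_eq_star_dotProduct,
    sum_dotProduct, Matrix.vecMulVec_mulVec]
  refine Finset.sum_congr rfl fun s _ => ?_
  simp [dotProduct_comm, sq]

lemma norm_empMean_le {t : ℕ} {ω : Ω} (h : ∀ s, 1 ≤ s → ‖X s ω‖ ≤ 1 / 2) :
    ‖empMean X t ω‖ ≤ 1 / 2 := by
  rcases t.eq_zero_or_pos with rfl | ht
  · simp [empMean]
  have ht' : (0 : ℝ) < t := by exact_mod_cast ht
  rw [empMean, norm_smul, norm_inv, Real.norm_of_nonneg ht'.le, inv_mul_le_iff₀ ht']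
  refine (norm_sum_le_of_le _ fun s hs => h s (Finset.mem_Icc.1 hs).1).trans ?_
  simp

/-- One step of the empirical Bernstein supermartingale: a conditional exponential moment bound. -/
lemma condExp_exp_sub_psiE_le [IsProbabilityMeasure μ] {m : MeasurableSpace Ω} (hm : m ≤ mΩ)
    {Y a : Ω → ℝ} (hY : AEStronglyMeasurable[mΩ] Y μ) (ha : StronglyMeasurable[m] a)
    (hYb : ∀ᵐ ω ∂μ, |Y ω| ≤ 1 / 2) (hab : ∀ᵐ ω ∂μ, |a ω| ≤ 1 / 2) {l : ℝ} (h0 : 0 ≤ l)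
    (h1 : l < 1) :
    μ[fun ω => Real.exp (l * (Y ω - (μ[Y | m]) ω) - psiE 1 l * (Y ω - a ω) ^ 2) | m] ≤ᵐ[μ]
      fun _ => 1 := by
  have hYi : Integrable Y μ := Integrable.of_bound hY (1 / 2) hYb
  have hai : Integrable a μ := Integrable.of_bound (ha.mono hm).aestronglyMeasurable (1 / 2) hab
  have hmm : StronglyMeasurable[m] (μ[Y | m]) := stronglyMeasurable_condExp
  have hmb : ∀ᵐ ω ∂μ, |(μ[Y | m]) ω| ≤ 1 / 2 :=
    ae_bdd_abs_condExp_of_ae_bdd_abs hYb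
  -- Writing `Y - m = (a - m) + (Y - a)` splits the exponential into a predictable factor `g` and a
  -- factor `e` to which Fan's inequality applies.
  set g : Ω → ℝ := fun ω => Real.exp (l * (a ω - (μ[Y | m]) ω))
  have hg : StronglyMeasurable[m] g :=
    Real.continuous_exp.comp_stronglyMeasurable ((ha.sub hmm).const_mul l)
  have hgb : ∀ᵐ ω ∂μ, ‖g ω‖ ≤ Real.exp 1 := by
    filter_upwards [hab, hmb] with ω h2 h3
    rw [Real.norm_of_nonneg (Real.exp_pos _).le, Real.exp_le_exp]
    rw [abs_le] at h2 h3
    nlinarith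
  set e : Ω → ℝ := fun ω => Real.exp (l * (Y ω - a ω) - psiE 1 l * (Y ω - a ω) ^ 2)
  set f : Ω → ℝ := fun ω => 1 + l * (Y ω - a ω)
  have hfi : Integrable f μ := (integrable_const 1).add ((hYi.sub hai).const_mul l)
  have hef : e ≤ᵐ[μ] f := by
    filter_upwards [hYb, hab] with ω h2 h3
    rw [abs_le] at h2 h3
    -- The radius `1/2` matters here: `Y` and `a` both lie in `[-1/2, 1/2]`, so `Y - a ≥ -1`.
    exact exp_sub_psiE_le h0 h1 (by linarith)
  have hem : AEStronglyMeasurable[mΩ] e μ := by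
    have hYa := hY.sub (ha.mono hm).aestronglyMeasurable
    exact Real.continuous_exp.comp_aestronglyMeasurable
      ((hYa.const_mul l).sub ((hYa.pow 2).const_mul _))
  have hei : Integrable e μ := by
    refine hfi.mono hem ?_
    filter_upwards [hef] with ω hω
    have : 0 ≤ e ω := (Real.exp_pos _).le
    rw [Real.norm_of_nonneg this, Real.norm_of_nonneg (this.trans hω)]
    exact hω
  have e1 : (fun ω => Real.exp (l * (Y ω - (μ[Y | m]) ω) - psiE 1 l * (Y ω - a ω) ^ 2)) =
      g * e := by
    ext ω
    simp only [g, e, Pi.mul_apply, ← Real.exp_add]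
    congr 1; ring
  have hf : μ[f | m] =ᵐ[μ] fun ω => 1 + l * ((μ[Y | m]) ω - a ω) := by
    have h2 : μ[l • (Y - a) | m] =ᵐ[μ] l • μ[Y - a | m] := condExp_smul l _ m
    have h3 := condExp_sub hYi hai m
    have h4 := condExp_add (integrable_const (1 : ℝ)) ((hYi.sub hai).smul l) m
    rw [condExp_const hm] at h4
    rw [condExp_of_stronglyMeasurable hm ha hai] at h3
    filter_upwards [h2, h3, h4] with ω h2 h3 h4
    refine h4.trans ?_
    simp only [Pi.add_apply, h2, Pi.smul_apply, h3, Pi.sub_apply, smul_eq_mul]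
  rw [e1]
  filter_upwards [condExp_stronglyMeasurable_mul_of_bound hm hg hei _ hgb,
    condExp_mono (m := m) hei hfi hef, hf] with ω h2 h3 h4
  rw [h2, Pi.mul_apply]
  rw [h4] at h3
  refine (mul_le_mul_of_nonneg_left h3 (Real.exp_pos _).le).trans ?_
  -- The bias of the predictor `a` is absorbed by `1 + x ≤ exp x`, whose right side is exactly `1 /
  -- g`.
  have h5 := Real.add_one_le_exp (l * ((μ[Y | m]) ω - a ω))
  calc g ω * (1 + l * ((μ[Y | m]) ω - a ω))
      ≤ g ω * Real.exp (l * ((μ[Y | m]) ω - a ω)) :=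
        mul_le_mul_of_nonneg_left (by linarith) (Real.exp_pos _).le
    _ = 1 := by
        rw [← Real.exp_add, ← Real.exp_zero]; congr 1; ring

/-- The exponential process in direction `ν`. -/
noncomputable def expSupermartingale (μ : Measure Ω) (ℱ : Filtration ℕ mΩ)
    (X : ℕ → Ω → EuclideanSpace ℝ (Fin d)) (ν : EuclideanSpace ℝ (Fin d)) (l : ℝ) (t : ℕ)
    (ω : Ω) : ℝ :=
  Real.exp (l * inner ℝ ν (centeredSum μ ℱ X t ω) -
    psiE 1 l * inner ℝ ν (WithLp.toLp 2 (empVar X t ω *ᵥ ν.ofLp)))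

lemma stronglyAdapted_inner_centeredSum (hX : ∀ t, 1 ≤ t → StronglyMeasurable[ℱ t] (X t))
    (ν : EuclideanSpace ℝ (Fin d)) :
    StronglyAdapted ℱ fun t ω => (inner ℝ ν (centeredSum μ ℱ X t ω) : ℝ) := fun t =>
  (continuous_const.inner continuous_id).comp_stronglyMeasurable (stronglyAdapted_centeredSum hX t)

lemma stronglyAdapted_inner_empVar (hX : ∀ t, 1 ≤ t → StronglyMeasurable[ℱ t] (X t))
    (ν : EuclideanSpace ℝ (Fin d)) :
    StronglyAdapted ℱ fun t ω =>
      (inner ℝ ν (WithLp.toLp 2 (empVar X t ω *ᵥ ν.ofLp)) : ℝ) := by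
  intro t
  have hc : Continuous fun A : Matrix (Fin d) (Fin d) ℝ =>
      (inner ℝ ν (WithLp.toLp 2 (A *ᵥ ν.ofLp)) : ℝ) := by
    refine continuous_const.inner ((PiLp.continuous_toLp 2 _).comp ?_)
    fun_prop
  exact hc.comp_stronglyMeasurable (stronglyAdapted_empVar hX t)

lemma inner_empVar_nonneg (ν : EuclideanSpace ℝ (Fin d)) (t : ℕ) (ω : Ω) :
    0 ≤ (inner ℝ ν (WithLp.toLp 2 (empVar X t ω *ᵥ ν.ofLp)) : ℝ) := by
  rw [inner_empVar]
  exact Finset.sum_nonneg fun s _ => sq_nonneg _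

variable [IsProbabilityMeasure μ]

lemma ae_inner_condExp (hXb : ∀ t, 1 ≤ t → ∀ᵐ ω ∂μ, ‖X t ω‖ ≤ 1 / 2)
    (hX : ∀ t, 1 ≤ t → StronglyMeasurable[ℱ t] (X t)) (ν : EuclideanSpace ℝ (Fin d))
    {t : ℕ} (ht : 1 ≤ t) (m : MeasurableSpace Ω) :
    (fun ω => inner ℝ ν ((μ[X t | m]) ω)) =ᵐ[μ] μ[fun ω => inner ℝ ν (X t ω) | m] :=
  (innerSL ℝ ν).comp_condExp_comm
    (Integrable.of_bound ((hX t ht).mono (ℱ.le t)).aestronglyMeasurable _ (hXb t ht))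

/-- Each centred increment is at most `1/2 + 1/2`. The resulting bound `exp(l t)` on the exponential
process gives integrability and lets it be pulled out of conditional expectations. -/
lemma ae_abs_inner_centeredSum_le (hXb : ∀ t, 1 ≤ t → ∀ᵐ ω ∂μ, ‖X t ω‖ ≤ 1 / 2)
    (hX : ∀ t, 1 ≤ t → StronglyMeasurable[ℱ t] (X t))
    {ν : EuclideanSpace ℝ (Fin d)} (hν : ‖ν‖ = 1) (t : ℕ) :
    ∀ᵐ ω ∂μ, |inner ℝ ν (centeredSum μ ℱ X t ω)| ≤ t := by
  have hY : ∀ s, 1 ≤ s → ∀ᵐ ω ∂μ, |inner ℝ ν (X s ω)| ≤ 1 / 2 := by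
    intro s hs
    filter_upwards [hXb s hs] with ω hω
    exact (abs_real_inner_le_norm _ _).trans (by rw [hν, one_mul]; exact hω)
  have h1 : ∀ s, 1 ≤ s → ∀ᵐ ω ∂μ, |inner ℝ ν (X s ω - (μ[X s | ℱ (s - 1)]) ω)| ≤ 1 := by
    intro s hs
    filter_upwards [hY s hs, ae_inner_condExp hXb hX ν hs (ℱ (s - 1)),
      ae_bdd_abs_condExp_of_ae_bdd_abs (m := ℱ (s - 1)) (hY s hs)] with ω h2 h3 h4
    rw [inner_sub_right, h3]
    refine (abs_sub _ _).trans ?_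
    linarith
  have h2 : ∀ᵐ ω ∂μ, ∀ s, 1 ≤ s → |inner ℝ ν (X s ω - (μ[X s | ℱ (s - 1)]) ω)| ≤ 1 :=
    ae_all_iff.2 fun s => by
      by_cases hs : 1 ≤ s
      · filter_upwards [h1 s hs] with ω hω _ using hω
      · exact Filter.Eventually.of_forall fun ω h => absurd h hs
  filter_upwards [h2] with ω hω
  rw [centeredSum, inner_sum]
  refine (Finset.abs_sum_le_sum_abs _ _).trans ?_
  refine (Finset.sum_le_sum fun s hs => hω s (Finset.mem_Icc.1 hs).1).trans ?_
  simp

/-- Consecutive values differ by a factor `G` to which `condExp_exp_sub_psiE_le` applies. The mean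
in the new variance term is `μ̂_t`, hence `ℱ t`-measurable, which is why `empVar` uses the lagged
mean. -/
lemma supermartingale_expSupermartingale (hXb : ∀ t, 1 ≤ t → ∀ᵐ ω ∂μ, ‖X t ω‖ ≤ 1 / 2)
    (hX : ∀ t, 1 ≤ t → StronglyMeasurable[ℱ t] (X t))
    {ν : EuclideanSpace ℝ (Fin d)} (hν : ‖ν‖ = 1) {l : ℝ} (h0 : 0 ≤ l) (h1 : l < 1) :
    Supermartingale (expSupermartingale μ ℱ X ν l) ℱ μ := by
  have hadp : StronglyAdapted ℱ (expSupermartingale μ ℱ X ν l) := fun t =>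
    Real.continuous_exp.comp_stronglyMeasurable
      (((stronglyAdapted_inner_centeredSum hX ν t).const_mul l).sub
        ((stronglyAdapted_inner_empVar hX ν t).const_mul _))
  have hbd : ∀ t, ∀ᵐ ω ∂μ, ‖expSupermartingale μ ℱ X ν l t ω‖ ≤ Real.exp (l * t) := by
    intro t
    filter_upwards [ae_abs_inner_centeredSum_le hXb hX hν t] with ω hω
    rw [expSupermartingale, Real.norm_of_nonneg (Real.exp_pos _).le, Real.exp_le_exp]
    have h2 := mul_nonneg (psiE_one_nonneg h1) (inner_empVar_nonneg (X := X) ν t ω)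
    have h3 := mul_le_mul_of_nonneg_left (le_of_abs_le hω) h0
    linarith
  have hint : ∀ t, Integrable (expSupermartingale μ ℱ X ν l t) μ := fun t =>
    Integrable.of_bound ((hadp t).mono (ℱ.le t)).aestronglyMeasurable _ (hbd t)
  refine supermartingale_nat hadp hint fun t => ?_
  have hall : ∀ᵐ ω ∂μ, ∀ s, 1 ≤ s → ‖X s ω‖ ≤ 1 / 2 := ae_all_iff.2 fun s => by
    by_cases hs : 1 ≤ s
    · filter_upwards [hXb s hs] with ω hω _ using hω
    · exact Filter.Eventually.of_forall fun ω h => absurd h hs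
  have hin : ∀ x : EuclideanSpace ℝ (Fin d), ‖x‖ ≤ 1 / 2 → |inner ℝ ν x| ≤ 1 / 2 := fun x hx =>
    (abs_real_inner_le_norm _ _).trans (by rw [hν, one_mul]; exact hx)
  have hci : Continuous fun x : EuclideanSpace ℝ (Fin d) => (inner ℝ ν x : ℝ) :=
    continuous_const.inner continuous_id
  have hstep := condExp_exp_sub_psiE_le (μ := μ) (ℱ.le t)
    (Y := fun ω => inner ℝ ν (X (t + 1) ω)) (a := fun ω => inner ℝ ν (empMean X t ω))
    (hci.comp_aestronglyMeasurable ((hX (t + 1) (by omega)).mono (ℱ.le _)).aestronglyMeasurable)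
    (hci.comp_stronglyMeasurable (stronglyMeasurable_empMean hX t))
    (by filter_upwards [hall] with ω hω using hin _ (hω _ (by omega)))
    (by filter_upwards [hall] with ω hω using hin _ (norm_empMean_le hω)) h0 h1
  set G : Ω → ℝ := fun ω => Real.exp (l * (inner ℝ ν (X (t + 1) ω) -
    (μ[fun ω => inner ℝ ν (X (t + 1) ω) | ℱ t]) ω) -
    psiE 1 l * (inner ℝ ν (X (t + 1) ω) - inner ℝ ν (empMean X t ω)) ^ 2) with hG
  have hprod : expSupermartingale μ ℱ X ν l (t + 1) =ᵐ[μ] expSupermartingale μ ℱ X ν l t * G := by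
    filter_upwards [ae_inner_condExp hXb hX ν (t := t + 1) (by omega) (ℱ t)] with ω hω
    rw [Pi.mul_apply, hG, expSupermartingale, expSupermartingale, ← Real.exp_add]
    congr 1
    simp only [inner_empVar, centeredSum]
    rw [Finset.sum_Icc_succ_top (by omega), Finset.sum_Icc_succ_top (by omega), inner_add_right,
      Nat.add_sub_cancel, inner_sub_right, inner_sub_right, hω]
    ring
  have hGi : Integrable G μ := by
    have hG0 : AEStronglyMeasurable[mΩ] G μ := by
      have m1 : AEStronglyMeasurable[mΩ] (fun ω => (inner ℝ ν (X (t + 1) ω) : ℝ)) μ :=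
        hci.comp_aestronglyMeasurable ((hX (t + 1) (by omega)).mono (ℱ.le _)).aestronglyMeasurable
      have m2 : AEStronglyMeasurable[mΩ] (fun ω => (inner ℝ ν (empMean X t ω) : ℝ)) μ :=
        hci.comp_aestronglyMeasurable
          ((stronglyMeasurable_empMean hX t).mono (ℱ.le _)).aestronglyMeasurable
      have m3 : AEStronglyMeasurable[mΩ] (μ[fun ω => inner ℝ ν (X (t + 1) ω) | ℱ t]) μ :=
        integrable_condExp.aestronglyMeasurable
      exact Real.continuous_exp.comp_aestronglyMeasurable
        (((m1.sub m3).const_mul l).sub (((m1.sub m2).pow 2).const_mul _))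
    refine Integrable.of_bound hG0 (Real.exp 1) ?_
    have hYb : ∀ᵐ ω ∂μ, |(inner ℝ ν (X (t + 1) ω) : ℝ)| ≤ 1 / 2 := by
      filter_upwards [hall] with ω hω using hin _ (hω _ (by omega))
    filter_upwards [hYb, ae_bdd_abs_condExp_of_ae_bdd_abs (m := ℱ t) hYb] with ω h2 h3
    rw [Real.norm_of_nonneg (Real.exp_pos _).le, Real.exp_le_exp]
    have h4 := mul_nonneg (psiE_one_nonneg h1)
      (sq_nonneg ((inner ℝ ν (X (t + 1) ω) : ℝ) - inner ℝ ν (empMean X t ω)))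
    rw [abs_le] at h2 h3
    nlinarith
  filter_upwards [condExp_congr_ae (m := ℱ t) hprod,
    condExp_stronglyMeasurable_mul_of_bound (ℱ.le t) (hadp t) hGi _ (hbd t), hstep]
    with ω h2 h3 h4
  rw [h2, h3, Pi.mul_apply]
  exact mul_le_of_le_one_right (Real.exp_pos _).le h4

/-- `S_t` is sub-`ψ` with variance proxy `V_t` for every CGF-like `ψ` dominating `ψ_{E,1}`. -/
lemma isSubPsi_of_psiE_le {ψ : ℝ → ℝ} (hψ : IsCGFLike ψ 1)
    (hle : ∀ l, 0 ≤ l → l < 1 → psiE 1 l ≤ ψ l)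
    (hXb : ∀ t, 1 ≤ t → ∀ᵐ ω ∂μ, ‖X t ω‖ ≤ 1 / 2)
    (hX : ∀ t, 1 ≤ t → StronglyMeasurable[ℱ t] (X t)) :
    IsSubPsi μ ℱ ψ 1 (centeredSum μ ℱ X) (empVar X) := by
  refine ⟨hψ, stronglyAdapted_centeredSum hX, stronglyAdapted_empVar hX, posSemidef_empVar,
    fun ν hν => ⟨hψ, stronglyAdapted_inner_centeredSum hX ν, stronglyAdapted_inner_empVar hX ν,
      inner_empVar_nonneg ν, fun l hl => ?_⟩⟩
  rw [cgfDomain_one] at hl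
  -- The supermartingale built from `ψ_E` serves every larger `ψ`, because the variance proxy is
  -- nonnegative.
  refine ⟨expSupermartingale μ ℱ X ν l, supermartingale_expSupermartingale hXb hX hν hl.1 hl.2,
    fun t ω => (Real.exp_pos _).le, ?_, fun t => Filter.Eventually.of_forall fun ω => ?_⟩
  · simp [expSupermartingale, centeredSum, empVar]
  · rw [expSupermartingale, Real.exp_le_exp]
    have := mul_le_mul_of_nonneg_right (hle l hl.1 hl.2) (inner_empVar_nonneg (X := X) ν t ω)
    linarith

end EmpiricalBernstein

end EmpBern

/-! ### Geometry of the self-normalized norm. -/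

namespace EmpBern

/-- If `ν` is close to the direction `u` with `T u ∥ w`, then `T ν` has a small angle with `w`. -/
lemma exists_direction_of_symmetric {E : Type*} [NormedAddCommGroup E] [InnerProductSpace ℝ E]
    [Nontrivial E] {T Q : E →L[ℝ] E} (hT : ∀ x y, (inner ℝ (T x) y : ℝ) = inner ℝ x (T y))
    (hTQ : ∀ x, T (Q x) = x) {g G ε : ℝ} (hg : 0 < g) (hG : 0 < G)
    (hlow : ∀ x, g * ‖x‖ ≤ ‖T x‖) (hup : ∀ x, ‖T x‖ ≤ G * ‖x‖) (h0 : 0 ≤ ε) (h1 : ε ≤ 1) (S : E) :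
    ∃ u : E, ‖u‖ = 1 ∧ ∀ ν : E, ‖ν‖ = 1 → dist u ν ≤ ε / (G / g) →
      (1 - ε) * ‖Q S‖ * ‖T ν‖ ≤ inner ℝ ν S := by
  set w := Q S with hw
  have hS : S = T w := (hTQ S).symm
  rcases eq_or_ne w 0 with hw0 | hw0
  · obtain ⟨u, hu⟩ := exists_norm_eq E zero_le_one
    refine ⟨u, hu, fun ν _ _ => ?_⟩
    simp [hS, hw0]
  -- As `⟨x, S⟩ = ⟨T x, w⟩`, the ratio `⟨x, S⟩ / ‖T x‖` is largest when `T x` is a positive multiple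
  -- of `w`, that is, along `z = Q w`.
  set z := Q w with hz
  have hTz : T z = w := hTQ w
  have hz0 : z ≠ 0 := fun h => hw0 (by rw [← hTz, h, map_zero])
  have hzn : 0 < ‖z‖ := norm_pos_iff.2 hz0
  refine ⟨‖z‖⁻¹ • z, norm_smul_inv_norm hz0, fun ν hν hd => ?_⟩
  set u := ‖z‖⁻¹ • z with hu
  have hu1 : ‖u‖ = 1 := norm_smul_inv_norm hz0
  have hwz : w = ‖z‖ • T u := by
    rw [hu, map_smul, smul_smul, mul_inv_cancel₀ hzn.ne', one_smul, hTz]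
  have ha : g ≤ ‖T u‖ := by simpa [hu1] using hlow u
  have ha' : g ≤ ‖T ν‖ := by simpa [hν] using hlow ν
  have hdist : ‖T u - T ν‖ ≤ ε * g := by
    rw [← map_sub]
    refine (hup _).trans ?_
    rw [← dist_eq_norm]
    refine (mul_le_mul_of_nonneg_left hd hG.le).trans (le_of_eq ?_)
    field_simp
  have hsq := norm_sub_sq_real (T u) (T ν)
  have hd2 : ‖T u - T ν‖ ^ 2 ≤ (ε * g) ^ 2 := by gcongr
  have hgg : g * g ≤ ‖T u‖ * ‖T ν‖ := mul_le_mul ha ha' hg.le (hg.le.trans ha)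
  -- Polarization gives `2⟨Tu, Tν⟩ ≥ 2‖Tu‖‖Tν‖ - ε²g²`; then `g² ≤ ‖Tu‖‖Tν‖` and `ε² ≤ ε` finish
  -- with room to spare.
  have hcos : (1 - ε) * (‖T u‖ * ‖T ν‖) ≤ inner ℝ (T u) (T ν) := by
    have h2 : ε ^ 2 * (g * g) ≤ ε ^ 2 * (‖T u‖ * ‖T ν‖) := by gcongr
    have h3 : ε ^ 2 * (‖T u‖ * ‖T ν‖) ≤ ε * (‖T u‖ * ‖T ν‖) := by
      gcongr
      nlinarith
    have h4 : 0 ≤ ε * (‖T u‖ * ‖T ν‖) := by positivity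
    nlinarith [sq_nonneg (‖T u‖ - ‖T ν‖)]
  have e1 : (inner ℝ ν S : ℝ) = ‖z‖ * inner ℝ (T u) (T ν) := by
    conv_lhs => rw [hS, hwz, map_smul, inner_smul_right, ← hT, real_inner_comm]
  have e2 : ‖w‖ = ‖z‖ * ‖T u‖ := by
    conv_lhs => rw [hwz, norm_smul, norm_norm]
  rw [e1, e2]
  have := mul_le_mul_of_nonneg_left hcos hzn.le
  linarith

variable {d : ℕ}

/-- The quadratic form of a matrix. -/
noncomputable def quadForm (A : Matrix (Fin d) (Fin d) ℝ) (ν : EuclideanSpace ℝ (Fin d)) : ℝ :=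
  inner ℝ ν (WithLp.toLp 2 (A *ᵥ ν.ofLp))

/-- The spectrum is finite, so the continuity side conditions of the functional calculus are free.
-/
lemma continuousOn_spectrum (A : Matrix (Fin d) (Fin d) ℝ) (f : ℝ → ℝ) :
    ContinuousOn f (spectrum ℝ A) :=
  A.finite_real_spectrum.continuousOn f

-- Scalar inequalities on the spectrum pass to the Loewner order; the comparisons of `V ∨ ρ` with
-- `V`, `γ_min` and `γ_max` below are instances.
open scoped MatrixOrder in
lemma quadForm_cfc_mono {A : Matrix (Fin d) (Fin d) ℝ} {f g : ℝ → ℝ}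
    (h : ∀ x ∈ spectrum ℝ A, f x ≤ g x) (ν : EuclideanSpace ℝ (Fin d)) :
    quadForm (cfc f A) ν ≤ quadForm (cfc g A) ν := by
  have h1 : cfc f A ≤ cfc g A := cfc_mono h (continuousOn_spectrum A f) (continuousOn_spectrum A g)
  have h2 := (Matrix.le_iff.1 h1).dotProduct_mulVec_nonneg ν.ofLp
  rw [Matrix.sub_mulVec, dotProduct_sub] at h2
  simp only [quadForm, EuclideanSpace.inner_eq_star_dotProduct]
  rw [dotProduct_comm (cfc f A *ᵥ _), dotProduct_comm (cfc g A *ᵥ _)]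
  linarith

lemma quadForm_cfc_const {A : Matrix (Fin d) (Fin d) ℝ} (hA : IsSelfAdjoint A) (c : ℝ)
    (ν : EuclideanSpace ℝ (Fin d)) : quadForm (cfc (fun _ : ℝ => c) A) ν = c * ‖ν‖ ^ 2 := by
  rw [cfc_const c A hA, Algebra.algebraMap_eq_smul_one, quadForm, Matrix.smul_mulVec,
    Matrix.one_mulVec, WithLp.toLp_smul, WithLp.toLp_ofLp, inner_smul_right,
    real_inner_self_eq_norm_sq]

section SpecMax

variable {V : Matrix (Fin d) (Fin d) ℝ} {ρ : ℝ}

lemma spectrum_specMax (hV : IsSelfAdjoint V) :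
    spectrum ℝ (specMax V ρ) = (fun x : ℝ => max x ρ) '' spectrum ℝ V :=
  cfc_map_spectrum _ V (hf := continuousOn_spectrum V _) (ha := hV)

lemma spectrum_nonempty (hd : 1 ≤ d) (hV : IsSelfAdjoint V) : (spectrum ℝ V).Nonempty := by
  have : Nonempty (Fin d) := ⟨⟨0, hd⟩⟩
  have hH : V.IsHermitian := hV
  rw [hH.spectrum_real_eq_range_eigenvalues]
  exact Set.range_nonempty _

lemma gammaMin_specMax_le (hV : IsSelfAdjoint V) {x : ℝ} (hx : x ∈ spectrum ℝ V) :
    gammaMin (specMax V ρ) ≤ max x ρ := by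
  refine csInf_le (specMax V ρ).finite_real_spectrum.bddBelow ?_
  rw [spectrum_specMax hV]
  exact ⟨x, hx, rfl⟩

lemma le_gammaMax_specMax (hV : IsSelfAdjoint V) {x : ℝ} (hx : x ∈ spectrum ℝ V) :
    max x ρ ≤ gammaMax (specMax V ρ) := by
  refine le_csSup (specMax V ρ).finite_real_spectrum.bddAbove ?_
  rw [spectrum_specMax hV]
  exact ⟨x, hx, rfl⟩

lemma le_gammaMin_specMax (hd : 1 ≤ d) (hV : IsSelfAdjoint V) : ρ ≤ gammaMin (specMax V ρ) := by
  rw [gammaMin, spectrum_specMax hV]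
  refine le_csInf ((spectrum_nonempty hd hV).image _) ?_
  rintro _ ⟨x, -, rfl⟩
  exact le_max_right x ρ

lemma gammaMin_le_gammaMax_specMax (hd : 1 ≤ d) (hV : IsSelfAdjoint V) :
    gammaMin (specMax V ρ) ≤ gammaMax (specMax V ρ) := by
  obtain ⟨x, hx⟩ := spectrum_nonempty hd hV
  exact (gammaMin_specMax_le hV hx).trans (le_gammaMax_specMax hV hx)

lemma one_le_kappa_specMax (hd : 1 ≤ d) (hV : IsSelfAdjoint V) (hρ : 0 < ρ) :
    1 ≤ kappa (specMax V ρ) := by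
  rw [kappa, one_le_div (hρ.trans_le (le_gammaMin_specMax hd hV))]
  exact gammaMin_le_gammaMax_specMax hd hV

lemma quadForm_le_specMax (hV : IsSelfAdjoint V) (ν : EuclideanSpace ℝ (Fin d)) :
    quadForm V ν ≤ quadForm (specMax V ρ) ν := by
  conv_lhs => rw [← cfc_id' ℝ V hV]
  exact quadForm_cfc_mono (fun x _ => le_max_left x ρ) ν

lemma gammaMin_le_quadForm (hV : IsSelfAdjoint V) (ν : EuclideanSpace ℝ (Fin d)) :
    gammaMin (specMax V ρ) * ‖ν‖ ^ 2 ≤ quadForm (specMax V ρ) ν := by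
  rw [← quadForm_cfc_const hV]
  exact quadForm_cfc_mono (fun x hx => gammaMin_specMax_le hV hx) ν

lemma quadForm_le_gammaMax (hV : IsSelfAdjoint V) (ν : EuclideanSpace ℝ (Fin d)) :
    quadForm (specMax V ρ) ν ≤ gammaMax (specMax V ρ) * ‖ν‖ ^ 2 := by
  rw [← quadForm_cfc_const hV]
  exact quadForm_cfc_mono (fun x hx => le_gammaMax_specMax hV hx) ν

lemma quadForm_mul_self {R : Matrix (Fin d) (Fin d) ℝ} (hR : IsSelfAdjoint R)
    (ν : EuclideanSpace ℝ (Fin d)) :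
    quadForm (R * R) ν = ‖Matrix.toEuclideanCLM (n := Fin d) (𝕜 := ℝ) R ν‖ ^ 2 := by
  have hs : IsSelfAdjoint (Matrix.toEuclideanCLM (n := Fin d) (𝕜 := ℝ) R) :=
    hR.map (Matrix.toEuclideanCLM (n := Fin d) (𝕜 := ℝ))
  have e : quadForm (R * R) ν = inner ℝ ν (Matrix.toEuclideanCLM (n := Fin d) (𝕜 := ℝ) (R * R) ν) :=
    rfl
  rw [e, map_mul, mul_apply_eq_comp, ← real_inner_self_eq_norm_sq]
  exact (hs.isSymmetric _ _).symm

/-- Points `ν` of the sphere near a suitable direction `u` capture the self-normalized norm. -/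
lemma exists_direction_selfNorm (hd : 1 ≤ d) (hV : IsSelfAdjoint V) (hρ : 0 < ρ) {ε : ℝ}
    (h0 : 0 ≤ ε) (h1 : ε ≤ 1) (S : EuclideanSpace ℝ (Fin d)) :
    ∃ u : EuclideanSpace ℝ (Fin d), ‖u‖ = 1 ∧ ∀ ν : EuclideanSpace ℝ (Fin d), ‖ν‖ = 1 →
      dist u ν ≤ ε / Real.sqrt (kappa (specMax V ρ)) →
      (1 - ε) * selfNorm V ρ S * Real.sqrt (quadForm (specMax V ρ) ν) ≤ inner ℝ ν S := by
  have hmin : 0 < gammaMin (specMax V ρ) := hρ.trans_le (le_gammaMin_specMax hd hV)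
  have hmax := hmin.trans_le (gammaMin_le_gammaMax_specMax (ρ := ρ) hd hV)
  have : Nonempty (Fin d) := ⟨⟨0, hd⟩⟩
  -- The square root of `V ∨ ρ`, written as a function of `V` so that all identities reduce to
  -- scalar ones on the spectrum of `V`.
  set R : Matrix (Fin d) (Fin d) ℝ := cfc (fun x : ℝ => Real.sqrt (max x ρ)) V with hR
  have hRs : IsSelfAdjoint R := cfc_predicate _ _
  have hRR : R * R = specMax V ρ := by
    rw [hR, ← cfc_mul _ _ V (continuousOn_spectrum V _) (continuousOn_spectrum V _), specMax]
    refine cfc_congr fun x _ => ?_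
    exact Real.mul_self_sqrt (hρ.le.trans (le_max_right x ρ))
  have hQ : invSqrt (specMax V ρ) = cfc (fun x : ℝ => (Real.sqrt (max x ρ))⁻¹) V := by
    rw [invSqrt, specMax, ← cfc_comp' (fun x : ℝ => (Real.sqrt x)⁻¹) (fun x => max x ρ) V
      (((spectrum ℝ V).toFinite.image _).continuousOn _) (continuousOn_spectrum V _) hV]
  have hRQ : R * invSqrt (specMax V ρ) = 1 := by
    rw [hQ, hR, ← cfc_mul _ _ V (continuousOn_spectrum V _) (continuousOn_spectrum V _),
      ← cfc_one ℝ V hV]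
    refine cfc_congr fun x _ => ?_
    exact mul_inv_cancel₀ (Real.sqrt_pos.2 (hρ.trans_le (le_max_right x ρ))).ne'
  set T := Matrix.toEuclideanCLM (n := Fin d) (𝕜 := ℝ) R with hTdef
  set Q := Matrix.toEuclideanCLM (n := Fin d) (𝕜 := ℝ) (invSqrt (specMax V ρ)) with hQdef
  have hTs : IsSelfAdjoint T := hRs.map (Matrix.toEuclideanCLM (n := Fin d) (𝕜 := ℝ))
  have hTsq : ∀ x, ‖T x‖ ^ 2 = quadForm (specMax V ρ) x := fun x => by
    rw [← hRR, quadForm_mul_self hRs]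
  have hTQ : ∀ x, T (Q x) = x := fun x => by
    rw [← mul_apply_eq_comp, ← map_mul, hRQ, map_one, one_apply_eq_self]
  obtain ⟨u, hu, h⟩ := exists_direction_of_symmetric (T := T) (Q := Q)
    hTs.isSymmetric hTQ (Real.sqrt_pos.2 hmin) (Real.sqrt_pos.2 hmax)
    (fun x => by
      refine le_of_sq_le_sq ?_ (norm_nonneg _)
      rw [mul_pow, Real.sq_sqrt hmin.le, hTsq]
      exact gammaMin_le_quadForm hV x)
    (fun x => by
      refine le_of_sq_le_sq ?_ (by positivity)
      rw [mul_pow, Real.sq_sqrt hmax.le, hTsq]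
      exact quadForm_le_gammaMax hV x) h0 h1 S
  refine ⟨u, hu, fun ν hν hd => ?_⟩
  rw [kappa, Real.sqrt_div hmax.le] at hd
  have e : Real.sqrt (quadForm (specMax V ρ) ν) = ‖T ν‖ := by
    rw [← hTsq, Real.sqrt_sq (norm_nonneg _)]
  rw [e]
  exact h ν hν hd

end SpecMax

/-! ### Finite nets of the sphere. -/

section Covering

/-- Compactness of the sphere. Without finiteness, `toNat` in `sphereCovering` would return the
default value `0`. -/
lemma coveringNumber_sphere_ne_top (d : ℕ) {r : ℝ} (hr : 0 < r) :
    Metric.coveringNumber r.toNNReal (Metric.sphere (0 : EuclideanSpace ℝ (Fin d)) 1) ≠ ⊤ := by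
  obtain ⟨C, hC, hCf, hcov⟩ := Metric.exists_finite_isCover_of_isCompact
    (Real.toNNReal_pos.2 hr).ne' (isCompact_sphere (0 : EuclideanSpace ℝ (Fin d)) 1)
  exact ((hcov.coveringNumber_le_encard hC).trans_lt hCf.encard_lt_top).ne

lemma exists_sphere_net (d : ℕ) {r : ℝ} (hr : 0 < r) :
    ∃ K : Finset (EuclideanSpace ℝ (Fin d)), K.card = sphereCovering d r ∧
      (∀ ν ∈ K, ‖ν‖ = 1) ∧ ∀ u : EuclideanSpace ℝ (Fin d), ‖u‖ = 1 → ∃ ν ∈ K, dist u ν ≤ r := by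
  obtain ⟨C, hC, hCf, hcov, hcard⟩ := Metric.exists_set_encard_eq_coveringNumber
    (coveringNumber_sphere_ne_top d hr)
  refine ⟨hCf.toFinset, ?_, fun ν hν => ?_, fun u hu => ?_⟩
  · rw [sphereCovering, ← hcard, ← Set.ncard_eq_toFinset_card C hCf]
    rfl
  · simpa using hC (hCf.mem_toFinset.1 hν)
  · obtain ⟨ν, hν, h⟩ := hcov (by simpa using hu : u ∈ Metric.sphere 0 1)
    refine ⟨ν, hCf.mem_toFinset.2 hν, ?_⟩
    have h' : edist u ν ≤ ENNReal.ofReal r := h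
    rwa [edist_dist, ENNReal.ofReal_le_ofReal_iff hr.le] at h'

lemma sphereCovering_anti (d : ℕ) {r s : ℝ} (hr : 0 < r) (hrs : r ≤ s) :
    sphereCovering d s ≤ sphereCovering d r :=
  ENat.toNat_le_toNat (Metric.coveringNumber_anti (Real.toNNReal_le_toNNReal hrs))
    (coveringNumber_sphere_ne_top d hr)

lemma one_le_sphereCovering {d : ℕ} (hd : 1 ≤ d) {r : ℝ} (hr : 0 < r) :
    1 ≤ sphereCovering d r := by
  have : Nonempty (Fin d) := ⟨⟨0, hd⟩⟩
  obtain ⟨K, hK, -, h⟩ := exists_sphere_net d hr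
  obtain ⟨u, hu⟩ := exists_norm_eq (EuclideanSpace ℝ (Fin d)) zero_le_one
  obtain ⟨ν, hν, -⟩ := h u hu
  rw [← hK]
  exact Finset.card_pos.2 ⟨ν, hν⟩

end Covering

end EmpBern

/-! ### Stitching over variance and condition number scales. -/

namespace EmpBern

/-- The stitching step: for `v ∈ [r, αr]`, a single slope `l` depending only on `ℓ` and `r`
detects that `s` exceeds the curved boundary `v (ψ_E^*)⁻¹(αℓ'/v)`. -/
lemma le_line_of_boundary_le {l ℓ ℓ' α r v s q u : ℝ} (hℓ : 0 < ℓ) (hℓ' : ℓ ≤ ℓ')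
    (hr : 0 < r) (hrv : r ≤ v) (hvr : v ≤ α * r) (hu : u = convexConjInv (psiE 1) 1 (ℓ / r))
    (hl : l = u / (1 + u)) (hq : q ≤ v)
    (hs : v * convexConjInv (psiE 1) 1 (α * ℓ' / v) ≤ s) :
    ℓ ≤ l * s - psiE 1 l * q := by
  have hv : 0 < v := hr.trans_le hrv
  obtain ⟨hu0, hu1⟩ := convexConjInv_psiE_spec (div_pos hℓ hr).le
  -- The factor `α` is spent here: `v ≤ α r` and `ℓ ≤ ℓ'` give `ℓ / r ≤ α ℓ' / v`.
  have hle : u ≤ convexConjInv (psiE 1) 1 (α * ℓ' / v) := by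
    rw [hu]
    refine convexConjInv_psiE_mono (div_pos hℓ hr).le ?_
    rw [div_le_div_iff₀ hr hv]
    nlinarith [mul_le_mul_of_nonneg_left hvr (hℓ.trans_le hℓ').le,
      mul_le_mul_of_nonneg_right hℓ' hv.le]
  rw [← hu] at hu0 hu1
  obtain ⟨hl0, hl1⟩ := div_one_add_mem hu0
  rw [← hl] at hl0 hl1
  -- The slope `l` attains the conjugate at `u`, so `l u - ψ_E(l) = ℓ / r`; then `l s - ψ_E(l) q ≥ v
  -- (l u - ψ_E(l)) = v ℓ / r ≥ ℓ`.
  have e := mul_div_sub_psiE hu0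
  rw [← hl, hu1] at e
  have hs' : v * u ≤ s := (mul_le_mul_of_nonneg_left hle hv.le).trans hs
  have h1 := mul_le_mul_of_nonneg_left hs' hl0
  have h2 := mul_le_mul_of_nonneg_left hq (psiE_one_nonneg hl1)
  have h3 : ℓ ≤ v * (ℓ / r) := by
    rw [mul_div_assoc', le_div_iff₀ hr]
    nlinarith
  rw [← e] at h3
  linarith

section Stitching

variable {d : ℕ} {ρ α β ε δ : ℝ} {h : ℝ → ℝ}

/-- Probability budget of one direction at variance scale `k` and condition number scale `j`. -/
noncomputable def stitchProb (d : ℕ) (β ε δ : ℝ) (h : ℝ → ℝ) (k j : ℕ) : ℝ :=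
  δ * (1 - β⁻¹) * (β⁻¹) ^ j * (h k)⁻¹ / sphereCovering d (ε / β ^ (j + 1))

/-- The slope used at variance scale `k` and condition number scale `j`. -/
noncomputable def stitchSlope (d : ℕ) (ρ α β ε δ : ℝ) (h : ℝ → ℝ) (k j : ℕ) : ℝ :=
  convexConjInv (psiE 1) 1 (Real.log (1 / stitchProb d β ε δ h k j) / (ρ * α ^ k)) /
    (1 + convexConjInv (psiE 1) 1 (Real.log (1 / stitchProb d β ε δ h k j) / (ρ * α ^ k)))

lemma stitchProb_pos (hd : 1 ≤ d) (hβ : 1 < β) (hε : 0 < ε) (hδ : 0 < δ)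
    (hh : ∀ x, 0 ≤ x → 0 < h x) (k j : ℕ) : 0 < stitchProb d β ε δ h k j := by
  have h1 : 0 < β := by linarith
  have h2 : 0 < 1 - β⁻¹ := sub_pos.2 (inv_lt_one_of_one_lt₀ hβ)
  have h3 : (0 : ℝ) < sphereCovering d (ε / β ^ (j + 1)) := by
    exact_mod_cast one_le_sphereCovering hd (by positivity)
  have h4 := hh k (by positivity)
  unfold stitchProb
  positivity

lemma stitchProb_lt_one (hd : 1 ≤ d) (hβ : 1 < β) (hε : 0 < ε) (hδ : 0 < δ) (hδ1 : δ < 1)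
    (hh : ∀ x, 0 ≤ x → 0 < h x) (hsum : Summable fun k : ℕ => (h k)⁻¹)
    (hsum1 : ∑' k : ℕ, (h k)⁻¹ ≤ 1) (k j : ℕ) : stitchProb d β ε δ h k j < 1 := by
  have h1 : 0 < β := by linarith
  have h2 : 0 < 1 - β⁻¹ := sub_pos.2 (inv_lt_one_of_one_lt₀ hβ)
  have h2' : 1 - β⁻¹ ≤ 1 := by
    have := inv_pos.2 h1
    linarith
  have h3 : (1 : ℝ) ≤ sphereCovering d (ε / β ^ (j + 1)) := by
    exact_mod_cast one_le_sphereCovering hd (by positivity)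
  have h4 : ∀ k : ℕ, 0 < (h k)⁻¹ := fun k => inv_pos.2 (hh k (by positivity))
  -- A single term of a nonnegative series with sum at most one.
  have h5 : (h k)⁻¹ ≤ 1 := (hsum.le_tsum k fun i _ => (h4 i).le).trans hsum1
  have h6 : (β⁻¹) ^ j ≤ 1 := pow_le_one₀ (by positivity) (inv_le_one_of_one_le₀ hβ.le)
  have h7 := h4 k
  unfold stitchProb
  refine (div_le_self (by positivity) h3).trans_lt ?_
  calc δ * (1 - β⁻¹) * (β⁻¹) ^ j * (h k)⁻¹ ≤ δ * 1 * 1 * 1 := by gcongr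
    _ < 1 := by linarith

lemma log_inv_stitchProb_pos (hd : 1 ≤ d) (hβ : 1 < β) (hε : 0 < ε) (hδ : 0 < δ) (hδ1 : δ < 1)
    (hh : ∀ x, 0 ≤ x → 0 < h x) (hsum : Summable fun k : ℕ => (h k)⁻¹)
    (hsum1 : ∑' k : ℕ, (h k)⁻¹ ≤ 1) (k j : ℕ) : 0 < Real.log (1 / stitchProb d β ε δ h k j) :=
  Real.log_pos ((one_lt_div (stitchProb_pos hd hβ hε hδ hh k j)).2
    (stitchProb_lt_one hd hβ hε hδ hδ1 hh hsum hsum1 k j))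

/-- This dictates the shape of `Lfun`: the three logarithms dominate those of `h k`, of the
constant, and of `β^j N(ε/β^(j+1))`. The last uses `β^(j+1) ≤ β√κ`, so the net in `Lfun` is at least
as fine. -/
lemma log_inv_stitchProb_le_Lfun (hd : 1 ≤ d) (hρ : 0 < ρ) (hα : 1 < α) (hβ : 1 < β) (hε : 0 < ε)
    (hδ : 0 < δ) (hh : ∀ x, 0 ≤ x → 0 < h x) (hmono : MonotoneOn h (Set.Ici 0))
    {V : Matrix (Fin d) (Fin d) ℝ} {k j : ℕ}
    (hk : ρ * α ^ k ≤ gammaMax (specMax V ρ)) (hj : β ^ j ≤ Real.sqrt (kappa (specMax V ρ))) :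
    Real.log (1 / stitchProb d β ε δ h k j) ≤ Lfun α β ρ ε δ h V := by
  have hβ0 : 0 < β := by linarith
  have h2 : 0 < 1 - β⁻¹ := sub_pos.2 (inv_lt_one_of_one_lt₀ hβ)
  set N := (sphereCovering d (ε / β ^ (j + 1)) : ℝ) with hN
  have h3 : 0 < N := by
    rw [hN]
    exact_mod_cast one_le_sphereCovering hd (by positivity)
  have h4 := hh k (by positivity)
  have e : 1 / stitchProb d β ε δ h k j = h k * (1 / δ * (1 / (1 - β⁻¹))) * (β ^ j * N) := by
    rw [stitchProb, ← hN, inv_pow]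
    field_simp
  rw [e, Real.log_mul (by positivity) (by positivity), Real.log_mul (by positivity) (by positivity),
    Lfun]
  have hklog : (k : ℝ) ≤ Real.logb α (gammaMax (specMax V ρ) / ρ) := by
    have hmax : 0 < gammaMax (specMax V ρ) := lt_of_lt_of_le (by positivity) hk
    rw [Real.le_logb_iff_rpow_le hα (by positivity), Real.rpow_natCast, le_div_iff₀ hρ]
    linarith
  have hk0 : (0 : ℝ) ≤ k := by positivity
  have hsq : 0 < Real.sqrt (kappa (specMax V ρ)) := lt_of_lt_of_le (by positivity) hj
  gcongr
  · exact hmono hk0 (hk0.trans hklog) hklog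
  · exact hj.trans (le_mul_of_one_le_left hsq.le hβ.le)
  · rw [hN]
    refine Nat.cast_le.2 (sphereCovering_anti d (by positivity) ?_)
    rw [pow_succ']
    gcongr

/-- The cell `k = j = 0` is always admissible, since `γ_max(V ∨ ρ) ≥ ρ` and `κ ≥ 1`, and its
log-inverse budget is positive. -/
lemma Lfun_pos (hd : 1 ≤ d) (hρ : 0 < ρ) (hα : 1 < α) (hβ : 1 < β) (hε : 0 < ε)
    (hδ : 0 < δ) (hδ1 : δ < 1) (hh : ∀ x, 0 ≤ x → 0 < h x) (hmono : MonotoneOn h (Set.Ici 0))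
    (hsum : Summable fun k : ℕ => (h k)⁻¹) (hsum1 : ∑' k : ℕ, (h k)⁻¹ ≤ 1)
    {V : Matrix (Fin d) (Fin d) ℝ} (hV : IsSelfAdjoint V) : 0 < Lfun α β ρ ε δ h V := by
  refine (log_inv_stitchProb_pos hd hβ hε hδ hδ1 hh hsum hsum1 0 0).trans_le
    (log_inv_stitchProb_le_Lfun hd hρ hα hβ hε hδ hh hmono ?_ ?_)
  · simpa using (le_gammaMin_specMax hd hV).trans (gammaMin_le_gammaMax_specMax hd hV)
  · simpa using one_le_kappa_specMax hd hV hρ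

/-- If the self-normalized norm exceeds the boundary, one of countably many lines is crossed. -/
lemma exists_crossing (hd : 1 ≤ d) (hρ : 0 < ρ) (hα : 1 < α) (hβ : 1 < β) (hε : 0 < ε)
    (hε1 : ε < 1) (hδ : 0 < δ) (hδ1 : δ < 1) (hh : ∀ x, 0 ≤ x → 0 < h x)
    (hmono : MonotoneOn h (Set.Ici 0)) (hsum : Summable fun k : ℕ => (h k)⁻¹)
    (hsum1 : ∑' k : ℕ, (h k)⁻¹ ≤ 1) {K : ℕ → Finset (EuclideanSpace ℝ (Fin d))}
    (hK1 : ∀ j, ∀ ν ∈ K j, ‖ν‖ = 1)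
    (hK : ∀ j, ∀ u : EuclideanSpace ℝ (Fin d), ‖u‖ = 1 → ∃ ν ∈ K j, dist u ν ≤ ε / β ^ (j + 1))
    {V : Matrix (Fin d) (Fin d) ℝ} (hV : IsSelfAdjoint V) (S : EuclideanSpace ℝ (Fin d))
    (hS : selfNorm V ρ S ≥ Real.sqrt (gammaMin (specMax V ρ)) / (1 - ε) *
      convexConjInv (psiE 1) 1 (α * Lfun α β ρ ε δ h V / gammaMin (specMax V ρ))) :
    ∃ k j, ∃ ν ∈ K j, Real.log (1 / stitchProb d β ε δ h k j) ≤
      stitchSlope d ρ α β ε δ h k j * inner ℝ ν S -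
        psiE 1 (stitchSlope d ρ α β ε δ h k j) * quadForm V ν := by
  have hβ0 : 0 < β := by linarith
  have hmin := le_gammaMin_specMax (ρ := ρ) hd hV
  have hmin0 := hρ.trans_le hmin
  have hκ : 1 ≤ Real.sqrt (kappa (specMax V ρ)) := by
    simpa using one_le_kappa_specMax hd hV hρ
  -- From `√κ < β^(j+1)`, the deterministic net of radius `ε/β^(j+1)` is fine enough for this random
  -- `κ`.
  obtain ⟨j, hj, hj'⟩ := exists_nat_pow_near hκ hβ
  obtain ⟨u, hu, hdir⟩ := exists_direction_selfNorm hd hV hρ hε.le hε1.le S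
  obtain ⟨ν, hνK, hdist⟩ := hK j u hu
  have hν := hK1 j ν hνK
  have hdir' := hdir ν hν (hdist.trans (by gcongr))
  have hv1 := gammaMin_le_quadForm (ρ := ρ) hV ν
  have hv2 := quadForm_le_gammaMax (ρ := ρ) hV ν
  rw [hν, one_pow, mul_one] at hv1 hv2
  set v := quadForm (specMax V ρ) ν with hv
  have hv0 : 0 < v := hmin0.trans_le hv1
  -- The variance scale is that of the quadratic form in the chosen direction `ν`, not of an
  -- eigenvalue.
  obtain ⟨k, hk, hk'⟩ := exists_nat_pow_near
    ((one_le_div hρ).2 (hmin.trans hv1)) hα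
  rw [le_div_iff₀ hρ, mul_comm] at hk
  rw [div_lt_iff₀ hρ, pow_succ'] at hk'
  have hL := Lfun_pos hd hρ hα hβ hε hδ hδ1 hh hmono hsum hsum1 hV
  refine ⟨k, j, ν, hνK, le_line_of_boundary_le (α := α)
    (log_inv_stitchProb_pos hd hβ hε hδ hδ1 hh hsum hsum1 k j)
    (log_inv_stitchProb_le_Lfun hd hρ hα hβ hε hδ hh hmono (hk.trans hv2) hj)
    (by positivity) hk (by linarith) rfl rfl (quadForm_le_specMax hV ν) ?_⟩
  refine le_trans ?_ hdir'
  -- The assumed boundary sits at `γ_min ≤ v`, where it is at least as high as the one needed at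
  -- `v`.
  have hanti := sqrt_mul_convexConjInv_psiE_anti
    (c := α * Lfun α β ρ ε δ h V) (by positivity) hmin0 hv1
  have hε' : 0 < 1 - ε := by linarith
  have hS' : Real.sqrt (gammaMin (specMax V ρ)) *
      convexConjInv (psiE 1) 1 (α * Lfun α β ρ ε δ h V / gammaMin (specMax V ρ)) ≤
      (1 - ε) * selfNorm V ρ S := by
    rw [ge_iff_le, div_mul_eq_mul_div, div_le_iff₀ hε'] at hS
    linarith
  have h1 := mul_le_mul_of_nonneg_right (hanti.trans hS') (Real.sqrt_nonneg v)
  have h2 := Real.mul_self_sqrt hv0.le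
  calc v * convexConjInv (psiE 1) 1 (α * Lfun α β ρ ε δ h V / v)
      = Real.sqrt v * convexConjInv (psiE 1) 1 (α * Lfun α β ρ ε δ h V / v) * Real.sqrt v := by
        nth_rewrite 1 [← h2]; ring
    _ ≤ _ := h1

/-- The budgets of all lines sum up to at most `δ`. -/
lemma tsum_stitchProb_le (hd : 1 ≤ d) (hβ : 1 < β) (hε : 0 < ε) (hδ : 0 < δ)
    (hh : ∀ x, 0 ≤ x → 0 < h x) (hsum : Summable fun k : ℕ => (h k)⁻¹)
    (hsum1 : ∑' k : ℕ, (h k)⁻¹ ≤ 1) :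
    ∑' k : ℕ, ∑' j : ℕ, (sphereCovering d (ε / β ^ (j + 1)) : ENNReal) *
      ENNReal.ofReal (stitchProb d β ε δ h k j) ≤ ENNReal.ofReal δ := by
  have hβ0 : 0 < β := by linarith
  have hβ1 : β⁻¹ < 1 := inv_lt_one_of_one_lt₀ hβ
  have h2 : 0 < 1 - β⁻¹ := sub_pos.2 hβ1
  have h4 : ∀ k : ℕ, 0 ≤ (h k)⁻¹ := fun k => (inv_pos.2 (hh k (by positivity))).le
  -- The cardinality of the net cancels the one in the budget, leaving a product of `1/h(k)` and a
  -- geometric term.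
  have e : ∀ k j : ℕ, (sphereCovering d (ε / β ^ (j + 1)) : ENNReal) *
      ENNReal.ofReal (stitchProb d β ε δ h k j) =
      ENNReal.ofReal (h k)⁻¹ * (ENNReal.ofReal (δ * (1 - β⁻¹)) * ENNReal.ofReal ((β⁻¹) ^ j)) := by
    intro k j
    have h3 : (sphereCovering d (ε / β ^ (j + 1)) : ℝ) ≠ 0 := by
      have := one_le_sphereCovering hd (r := ε / β ^ (j + 1)) (by positivity)
      exact_mod_cast (by omega)
    rw [← ENNReal.ofReal_natCast, ← ENNReal.ofReal_mul (by positivity),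
      ← ENNReal.ofReal_mul (by positivity), ← ENNReal.ofReal_mul (h4 k), stitchProb]
    congr 1
    field_simp
  simp_rw [e, ENNReal.tsum_mul_left, ENNReal.tsum_mul_right]
  rw [← ENNReal.ofReal_tsum_of_nonneg h4 hsum, ← ENNReal.ofReal_tsum_of_nonneg
    (fun j => by positivity) (summable_geometric_of_lt_one (by positivity) hβ1),
    tsum_geometric_of_lt_one (by positivity) hβ1, ← ENNReal.ofReal_mul (by positivity),
    ← ENNReal.ofReal_mul (tsum_nonneg h4)]
  refine ENNReal.ofReal_le_ofReal ?_
  rw [mul_assoc δ, mul_inv_cancel₀ h2.ne', mul_one]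
  exact mul_le_of_le_one_left hδ.le hsum1

/-- The time-uniform self-normalized bound for processes that are sub-`ψ_{E,1}`. -/
lemma IsSubPsi.measure_selfNorm_ge_le {Ω : Type*} {mΩ : MeasurableSpace Ω} {μ : Measure Ω}
    [IsFiniteMeasure μ] {ℱ : Filtration ℕ mΩ} {S : ℕ → Ω → EuclideanSpace ℝ (Fin d)}
    {V : ℕ → Ω → Matrix (Fin d) (Fin d) ℝ} (hSV : IsSubPsi μ ℱ (psiE 1) 1 S V)
    (hd : 1 ≤ d) (hρ : 0 < ρ) (hα : 1 < α) (hβ : 1 < β) (hε : 0 < ε)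
    (hε1 : ε < 1) (hδ : 0 < δ) (hδ1 : δ < 1) (hh : ∀ x, 0 ≤ x → 0 < h x)
    (hmono : MonotoneOn h (Set.Ici 0)) (hsum : Summable fun k : ℕ => (h k)⁻¹)
    (hsum1 : ∑' k : ℕ, (h k)⁻¹ ≤ 1) :
    μ {ω | ∃ t : ℕ, selfNorm (V t ω) ρ (S t ω) ≥
      Real.sqrt (gammaMin (specMax (V t ω) ρ)) / (1 - ε) *
        convexConjInv (psiE 1) 1
          (α * Lfun α β ρ ε δ h (V t ω) / gammaMin (specMax (V t ω) ρ))} ≤ ENNReal.ofReal δ := by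
  have hβ0 : 0 < β := by linarith
  have hα0 : 0 < α := by linarith
  choose K hKcard hK1 hK using fun j : ℕ => exists_sphere_net d (r := ε / β ^ (j + 1))
    (by positivity)
  set B : ℕ → ℕ → EuclideanSpace ℝ (Fin d) → Set Ω := fun k j ν =>
    {ω | ∃ t, Real.log (1 / stitchProb d β ε δ h k j) ≤
      stitchSlope d ρ α β ε δ h k j * inner ℝ ν (S t ω) -
        psiE 1 (stitchSlope d ρ α β ε δ h k j) * quadForm (V t ω) ν} with hB
  have hslope : ∀ k j, stitchSlope d ρ α β ε δ h k j ∈ cgfDomain 1 := fun k j => by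
    rw [cgfDomain_one]
    exact div_one_add_mem (convexConjInv_psiE_spec (div_pos
      (log_inv_stitchProb_pos hd hβ hε hδ hδ1 hh hsum hsum1 k j) (by positivity)).le).1
  have hBle : ∀ k j, ∀ ν ∈ K j, μ (B k j ν) ≤ ENNReal.ofReal (stitchProb d β ε δ h k j) :=
    fun k j ν hν => (hSV.projection ν (hK1 j ν hν)).measure_crossing_le (hslope k j)
      (stitchProb_pos hd hβ hε hδ hh k j)
  calc _ ≤ μ (⋃ k, ⋃ j, ⋃ ν ∈ K j, B k j ν) := by
        refine measure_mono ?_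
        rintro ω ⟨t, ht⟩
        obtain ⟨k, j, ν, hν, hc⟩ := exists_crossing hd hρ hα hβ hε hε1 hδ hδ1 hh hmono hsum hsum1
          hK1 hK (hSV.V_posSemidef t ω).1 (S t ω) ht
        simp only [Set.mem_iUnion]
        exact ⟨k, j, ν, hν, t, hc⟩
    _ ≤ ∑' k, ∑' j, ∑ ν ∈ K j, μ (B k j ν) :=
        (measure_iUnion_le _).trans (ENNReal.tsum_le_tsum fun k =>
          (measure_iUnion_le _).trans (ENNReal.tsum_le_tsum fun j =>
            measure_biUnion_finset_le _ _))
    _ ≤ ∑' k : ℕ, ∑' j : ℕ, (sphereCovering d (ε / β ^ (j + 1)) : ENNReal) *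
          ENNReal.ofReal (stitchProb d β ε δ h k j) := by
        refine ENNReal.tsum_le_tsum fun k => ENNReal.tsum_le_tsum fun j => ?_
        refine (Finset.sum_le_card_nsmul _ _ _ (hBle k j)).trans (le_of_eq ?_)
        rw [nsmul_eq_mul, hKcard]
    _ ≤ ENNReal.ofReal δ := tsum_stitchProb_le hd hβ hε hδ hh hsum hsum1

/-- An explicit upper bound for the boundary. -/
lemma sqrt_mul_convexConjInv_psiE_le {c g : ℝ} (hc : 0 ≤ c) (hg : 0 < g) :
    Real.sqrt g * convexConjInv (psiE 1) 1 (c / g) ≤ Real.sqrt (2 * c) + c / Real.sqrt g := by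
  have hs := Real.sqrt_pos.2 hg
  have h1 := mul_le_mul_of_nonneg_left (convexConjInv_psiE_le_sqrt (div_nonneg hc hg.le)) hs.le
  refine h1.trans (le_of_eq ?_)
  rw [mul_add, ← Real.sqrt_mul hg.le]
  congr 1
  · congr 1
    field_simp
  · rw [mul_div_assoc', div_eq_div_iff hg.ne' hs.ne']
    nth_rewrite 3 [← Real.mul_self_sqrt hg.le]
    ring

end Stitching

end EmpBern

/-! ### Assembly of the theorem. -/

theorem theorem6p1 {Ω : Type*} {mΩ : MeasurableSpace Ω} (μ : Measure Ω) [IsProbabilityMeasure μ]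
    (ℱ : Filtration ℕ mΩ) {d : ℕ} (hd : 1 ≤ d)
    (X : ℕ → Ω → EuclideanSpace ℝ (Fin d))
    (hX_adapted : ∀ t, 1 ≤ t → StronglyMeasurable[ℱ t] (X t))
    (hX_bound : ∀ t, 1 ≤ t → ∀ᵐ ω ∂μ, ‖X t ω‖ ≤ 1 / 2) :
    EmpBern.IsSubPsi μ ℱ (EmpBern.psiE 1) 1 (EmpBern.centeredSum μ ℱ X) (EmpBern.empVar X) ∧
    EmpBern.IsSubPsi μ ℱ (EmpBern.psiG 1) 1 (EmpBern.centeredSum μ ℱ X) (EmpBern.empVar X) ∧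
    ∀ (ρ α β ε δ : ℝ) (h : ℝ → ℝ), 0 < ρ → 1 < α → 1 < β → 0 < ε → ε < 1 → 0 < δ → δ < 1 →
      (∀ x, 0 ≤ x → 0 < h x) → MonotoneOn h (Set.Ici 0) →
      Summable (fun k : ℕ => (h k)⁻¹) → ∑' k : ℕ, (h k)⁻¹ ≤ 1 →
      μ {ω | ∃ t : ℕ,
          EmpBern.selfNorm (EmpBern.empVar X t ω) ρ (EmpBern.centeredSum μ ℱ X t ω) ≥
            Real.sqrt (EmpBern.gammaMin (EmpBern.specMax (EmpBern.empVar X t ω) ρ)) / (1 - ε) *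
              EmpBern.convexConjInv (EmpBern.psiE 1) 1
                (α * EmpBern.Lfun α β ρ ε δ h (EmpBern.empVar X t ω) /
                  EmpBern.gammaMin (EmpBern.specMax (EmpBern.empVar X t ω) ρ))}
        ≤ ENNReal.ofReal δ ∧
      μ {ω | ∀ t : ℕ,
          EmpBern.selfNorm (EmpBern.empVar X t ω) ρ (EmpBern.centeredSum μ ℱ X t ω) ≤
            1 / (1 - ε) *
              (Real.sqrt (2 * α * EmpBern.Lfun α β ρ ε δ h (EmpBern.empVar X t ω)) +
                α * EmpBern.Lfun α β ρ ε δ h (EmpBern.empVar X t ω) /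
                  Real.sqrt (EmpBern.gammaMin (EmpBern.specMax (EmpBern.empVar X t ω) ρ)))}ᶜ
        ≤ ENNReal.ofReal δ := by
  have hE := EmpBern.isSubPsi_of_psiE_le EmpBern.isCGFLike_psiE (fun _ _ _ => le_rfl)
    hX_bound hX_adapted
  refine ⟨hE, EmpBern.isSubPsi_of_psiE_le EmpBern.isCGFLike_psiG
    (fun _ h0 h1 => EmpBern.psiE_le_psiG h0 h1) hX_bound hX_adapted, ?_⟩
  intro ρ α β ε δ h hρ hα hβ hε hε1 hδ hδ1 hh hmono hsum hsum1
  have hmain := hE.measure_selfNorm_ge_le hd hρ hα hβ hε hε1 hδ hδ1 hh hmono hsum hsum1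
  refine ⟨hmain, (measure_mono fun ω hω => ?_).trans hmain⟩
  simp only [Set.mem_compl_iff, Set.mem_ofPred_eq, not_forall, not_le] at hω
  obtain ⟨t, ht⟩ := hω
  -- The explicit bound dominates the implicit boundary, so a time violating the former lies in the
  -- event already controlled by `hmain`.
  refine ⟨t, le_trans ?_ ht.le⟩
  have hV : IsSelfAdjoint (EmpBern.empVar X t ω) := (EmpBern.posSemidef_empVar t ω).1
  have hL := EmpBern.Lfun_pos hd hρ hα hβ hε hδ hδ1 hh hmono hsum hsum1 hV
  have hg := hρ.trans_le (EmpBern.le_gammaMin_specMax (ρ := ρ) hd hV)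
  have hε' : 0 < 1 - ε := by linarith
  rw [div_mul_eq_mul_div, one_div_mul_eq_div, mul_assoc 2 α]
  gcongr
  exact EmpBern.sqrt_mul_convexConjInv_psiE_le (by positivity) hg
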